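/- Let $\kappa:\mathbb R^d\times\mathbb R^d\to\mathbb R$ be a positive-definite kernel that is twice continuously differentiable, with $\kappa(x,x)$ bounded and with mixed second derivatives $\partial_v\partial'_v\kappa(x,x)$ bounded over all $x$ and all unit vectors $v$. Let $\mathcal H_\kappa^d$ be the vector-valued RKHS with kernel $\kappa(x,y)I_d$. Let $Q$ and $P_*$ be probability measures on the space $\mathcal F$ of all maps $h:\mathbb R^d\to\mathbb R^d$ with its product $\sigma$-algebra. For $g\in\mathcal H_\kappa^d$ let $T_g(h)(\omega)=h(\omega)+g(h(\omega))$ and $Q_g=T_g\#Q$. For a matrix $\Omega=[\omega_1,\dots,\omega_n]^{\mathsf T}\in\mathbb R^{n\times d}$ write $h(\Omega)=[h(\omega_1),\dots,h(\omega_n)]^{\mathsf T}$. The functional gradient at $g$ of $F:\mathcal H_\kappa^d\to[0,\infty]$ is the element $\nabla F[g]$ of $\mathcal H_\kappa^d$ such that, for every $f\in\mathcal H_\kappa^d$, $F[g+\epsilon f]$ is finite for all small $\epsilon$ and $F[g+\epsilon f]=F[g]+\epsilon\langle\nabla F[g],f\rangle_\kappa+O(\epsilon^2)$ as $\epsilon\to0$.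 For a matrix $M$ with rows $m_1,\dots,m_n$ and a density $p$ on $\mathbb R^{n\times d}$ put $$\kappa(\cdot,M)\nabla_M\log p(M)=\sum_{i=1}^n\kappa(\cdot,m_i)\nabla_{m_i}\log p(M),\qquad \nabla_M\kappa(\cdot,M)=\sum_{i=1}^n\nabla_{m_i}\kappa(\cdot,m_i);$$ these are elements of $\mathcal H_\kappa^d$. Say that $\Omega$ is *regular* if the law of $h(\Omega)$ under $P_*$ has a positive differentiable Lebesgue density $p_*$, the derivative of $\log p_*$ is integrable with respect to the law $q$ of $h(\Omega)$ under $Q$, and there are $\delta>0$ and a $q$-integrable function $L$ such that, for $q$-almost every $M$ and all $\|\Delta\|\le\delta$, the derivatives of $\log p_*$ at $M+\Delta$ and at $M$ differ by at most $L(M)\|\Delta\|$. 1. Let $\Omega^*\in\mathbb R^{n^*\times d}$ be regular, let $\mathrm{KL}(Q\|P_*)<\infty$, and assume that for every $f\in\mathcal H_\kappa^d$ and all sufficiently small $\epsilon$ the supremum, over all $n$ and all $\Omega_n\in\mathbb R^{n\times d}$, of the divergences between the laws of $h(\Omega_n)$ under $Q_{\epsilon f}$ and under $P_*$ is reached at $(n^*,\Omega^*)$.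 Then, with $H^*=h(\Omega^*)$, $$\nabla_g\mathrm{KL}(Q_g\|P_*)\big|_{g=0}=-\mathbb E_{h\sim Q}\big[\kappa(\cdot,H^*)\nabla_{H^*}\log p_*(H^*)+\nabla_{H^*}\kappa(\cdot,H^*)\big],$$ where the expectation exists as a Bochner integral in $\mathcal H_\kappa^d$. If this gradient $G$ is nonzero, $-G/\|G\|_\kappa$ is the unique unit direction of steepest descent (least directional derivative at $g=0$ among unit vectors). 2. Let $\hat\pi=\frac1R\sum_{i=1}^R\delta_{\omega_i}$ be an empirical base measure such that $\Omega_R=[\omega_1,\dots,\omega_R]^{\mathsf T}$ is regular, and let $\mathrm{KL}_{\hat\pi}$ denote the divergence between the processes restricted to the support of $\hat\pi$. If $\mathrm{KL}_{\hat\pi}(Q\|P_*)<\infty$ then, with $q$ the law of $H=h(\Omega_R)\in\mathbb R^{R\times d}$ under $Q$, $$\nabla_g\mathrm{KL}_{\hat\pi}(Q_g\|P_*)\big|_{g=0}=-\mathbb E_{H\sim q}\big[\kappa(\cdot,H)\nabla_H\log p_*(H)+\nabla_H\kappa(\cdot,H)\big],$$ with the same existence and steepest-descent statements. 3. For matrices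 $\Omega_1,\dots,\Omega_N\in\mathbb R^{R\times d}$, $\varepsilon\in\mathbb R$ and a positive differentiable $p:\mathbb R^{R\times d}\to\mathbb R$, let $\phi\in\mathcal H_\kappa^d$ be the expectation in part 2 with $p$ in place of $p_*$ and the empirical measure $\frac1N\sum_j\delta_{\Omega_j}$ in place of $q$. Then moving each row $\omega$ of $\Omega_m$ to $\omega+\varepsilon\phi(\omega)$ is the SVGD update $$\Omega_m\mapsto\Omega_m+\frac{\varepsilon}{N}\sum_{j=1}^N\big[\kappa(\Omega_m,\Omega_j)\nabla_{\Omega_j}\log p(\Omega_j)+\nabla_{\Omega_j}\kappa(\Omega_m,\Omega_j)\big],$$ where $\kappa(\Omega,\Omega')$ is the matrix with entries $\kappa(\omega_i,\omega'_j)$ and $\nabla_{\Omega'}\kappa(\Omega,\Omega')$ has rows $\sum_j\nabla_{\omega'_j}\kappa(\omega_i,\omega'_j)$. -/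

import Mathlib

open MeasureTheory InformationTheory Filter Topology Asymptotics
open scoped ENNReal

noncomputable section

namespace SteinProcess

/-- Frequencies: `ℝᵈ` with the Euclidean inner product. -/
abbrev Pt (d : ℕ) : Type := EuclideanSpace ℝ (Fin d)

/-- Matrices in `ℝⁿˣᵈ`, given by their `n` rows in `ℝᵈ`. -/
abbrev Mat (n d : ℕ) : Type := Fin n → Pt d

/-- The space of all maps from `ℝᵈ` to itself, with the product (cylinder) `σ`-algebra. A
probability measure on it is the law of an `ℝᵈ`-valued stochastic process indexed by `ℝᵈ`. -/
abbrev Fun (d : ℕ) : Type := Pt d → Pt d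

/-- The map `T_g` on functions, `T_g(h)(ω) = h(ω) + g(h(ω))`. -/
def transport {d : ℕ} (g : Pt d → Pt d) (h : Fun d) : Fun d :=
  fun ω => h ω + g (h ω)

/-- Matrix-valued evaluation `h ↦ h(Ω) = [h(ω₁), …, h(ωₙ)]ᵀ`. -/
def evalAt {n d : ℕ} (Ω : Mat n d) (h : Fun d) : Mat n d :=
  fun i => h (Ω i)

/-- The joint law on `ℝⁿˣᵈ` of `h(Ω)`, for `h` distributed according to `Q`. -/
def marginal {n d : ℕ} (Ω : Mat n d) (Q : Measure (Fun d)) : Measure (Mat n d) :=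
  Q.map (evalAt Ω)

/-- The supremum, over all `n` and all `n`-by-`d` matrices of inputs, of the Kullback-Leibler
divergences between finite-dimensional marginals. -/
def marginalKLSup {d : ℕ} (Q P : Measure (Fun d)) : ℝ≥0∞ :=
  ⨆ (n : ℕ) (Ω : Mat n d), klDiv (marginal Ω Q) (marginal Ω P)

/-- The supremum of the marginal divergences is reached at the matrix of inputs `Ω`. -/
def KLSupReachedAt {n d : ℕ} (Q P : Measure (Fun d)) (Ω : Mat n d) : Prop :=
  klDiv (marginal Ω Q) (marginal Ω P) = marginalKLSup Q P

/-- The Kullback-Leibler divergence between two processes restricted to the index set `X`. -/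
def klDivOn {d : ℕ} (X : Set (Pt d)) (Q P : Measure (Fun d)) : ℝ≥0∞ :=
  klDiv (Q.map X.domRestrict) (P.map X.domRestrict)

/-- The empirical measure `(1/R) ∑ᵢ δ_{xᵢ}` of `R` points. -/
def empiricalMeasure {α : Type*} [MeasurableSpace α] {R : ℕ} (x : Fin R → α) : Measure α :=
  (R : ℝ≥0∞)⁻¹ • ∑ i, Measure.dirac (x i)

/-- The `i`-th row of the matrix gradient `∇_M log p(M)`: the gradient of `log p` in the `i`-th
row of `M`, the other rows being kept fixed. -/
def score {n d : ℕ} (p : Mat n d → ℝ) (M : Mat n d) (i : Fin n) : Pt d :=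
  gradient (fun x => Real.log (p (Function.update M i x))) (M i)

/-- The kernel matrix `κ(Ω, Ω')`, with entries `κ(ωᵢ, ω'ⱼ)`. -/
def kernelMatrix {m n d : ℕ} (κ : Pt d → Pt d → ℝ) (Ω : Mat m d) (Ω' : Mat n d) :
    Matrix (Fin m) (Fin n) ℝ :=
  Matrix.of fun i j => κ (Ω i) (Ω' j)

/-- The kernel gradient `∇_{Ω'} κ(Ω, Ω')`, with rows `∑ⱼ ∇_{ω'ⱼ} κ(ωᵢ, ω'ⱼ)`. -/
def kernelGradient {m n d : ℕ} (κ : Pt d → Pt d → ℝ) (Ω : Mat m d) (Ω' : Mat n d) : Mat m d :=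
  fun i => ∑ j, gradient (κ (Ω i)) (Ω' j)

/-- The function `κ(·, M) ∇_M log p(M) + ∇_M κ(·, M)` from `ℝᵈ` to `ℝᵈ`, that is
`ω ↦ ∑ᵢ κ(ω, mᵢ) ∇_{mᵢ} log p(M) + ∑ᵢ ∇_{mᵢ} κ(ω, mᵢ)`, where `mᵢ` are the rows of `M`. -/
def steinField {n d : ℕ} (κ : Pt d → Pt d → ℝ) (p : Mat n d → ℝ) (M : Mat n d) (ω : Pt d) :
    Pt d :=
  ∑ i, κ ω (M i) • score p M i + ∑ i, gradient (κ ω) (M i)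

/-- One step, of size `ε`, of the SVGD update of `N` particles in `ℝᴿˣᵈ`:
`Ω_m + (ε/N) ∑ⱼ (κ(Ω_m, Ω_j) ∇_{Ω_j} log p(Ω_j) + ∇_{Ω_j} κ(Ω_m, Ω_j))`. -/
def svgdUpdate {N R d : ℕ} (κ : Pt d → Pt d → ℝ) (p : Mat R d → ℝ) (ε : ℝ)
    (Ω : Fin N → Mat R d) (m : Fin N) : Mat R d :=
  fun i => Ω m i + (ε / N) • ∑ j, (∑ k, kernelMatrix κ (Ω m) (Ω j) i k • score p (Ω j) k
    + kernelGradient κ (Ω m) (Ω j) i)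

/-- `G` is the functional gradient of `F` at `g`: for each direction `f`, the values
`F(g + εf)` are finite for small `ε`, and `F(g + εf) = F(g) + ε⟨G, f⟩ + O(ε²)` as `ε → 0`. -/
def HasFunctionalGradient {H : Type*} [NormedAddCommGroup H] [InnerProductSpace ℝ H]
    (F : H → ℝ≥0∞) (g G : H) : Prop :=
  ∀ f : H, (∀ᶠ ε : ℝ in 𝓝 0, F (g + ε • f) ≠ ∞) ∧
    (fun ε : ℝ => (F (g + ε • f)).toReal - (F g).toReal - ε * inner ℝ G f)
      =O[𝓝 0] fun ε : ℝ => ε ^ 2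

/-- The unit vector `u` is a direction of steepest descent of `F` at `g`: the directional
derivatives of `F` at `g` exist, and the one along `u` is the least among all unit vectors. -/
def IsSteepestDescentDirection {H : Type*} [NormedAddCommGroup H] [InnerProductSpace ℝ H]
    (F : H → ℝ≥0∞) (g u : H) : Prop :=
  ‖u‖ = 1 ∧ ∀ v : H, ‖v‖ = 1 → LineDifferentiableAt ℝ (fun f => (F f).toReal) g v ∧
    lineDeriv ℝ (fun f => (F f).toReal) g u ≤ lineDeriv ℝ (fun f => (F f).toReal) g v

/-- Regularity of a scalar kernel: it is twice continuously differentiable and bounded, and its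
mixed second derivative is bounded on the diagonal. -/
structure RegularKernel {d : ℕ} (κ : Pt d → Pt d → ℝ) : Prop where
  contDiff : ContDiff ℝ 2 (fun z : Pt d × Pt d => κ z.1 z.2)
  bounded : ∃ B : ℝ, ∀ x, κ x x ≤ B
  mixed_bounded : ∃ C : ℝ, ∀ x v : Pt d,
    fderiv ℝ (fun y => fderiv ℝ (κ y) x v) x v ≤ C * ‖v‖ ^ 2

/-- Regularity of a target law `P` on `ℝⁿˣᵈ`, relative to a law `q`: it has a positive
differentiable Lebesgue density `p`, the derivative of `log p` is `q`-integrable, and it is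
Lipschitz at small distances from `q`-almost every point `M`, with a constant `L(M)` that is
`q`-integrable. -/
structure RegularDensity {n d : ℕ} (q P : Measure (Mat n d)) (p : Mat n d → ℝ) : Prop where
  density : P = volume.withDensity (fun M => ENNReal.ofReal (p M))
  pos : ∀ M, 0 < p M
  differentiable : Differentiable ℝ p
  integrable : Integrable (fderiv ℝ (fun M => Real.log (p M))) q
  lipschitz : ∃ δ : ℝ, 0 < δ ∧ ∃ L : Mat n d → ℝ, Integrable L q ∧
    ∀ᵐ M ∂q, ∀ Δ : Mat n d, ‖Δ‖ ≤ δ →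
      ‖fderiv ℝ (fun M => Real.log (p M)) (M + Δ) - fderiv ℝ (fun M => Real.log (p M)) M‖
        ≤ L M * ‖Δ‖

end SteinProcess

end

/-! The map `T_g` acts on the values of `h`, so the law of `h(Ω)` under `Q_g` is the image of `q`
under `M ↦ M + g(M)`, with `g` applied to each row. Both gradients thereby become
finite-dimensional. In part 1 the divergence between processes is the supremum of the divergences
between marginals (`klDiv_eq_marginalKLSup`), reached at `Ω*` for every small multiple of a
direction. In part 2 the restriction to the support of the base measure and the evaluation at its
atoms determine each other.

Let `F` be `f` applied to rows. For small `ε` the map `e(M) = M + εF(M)` is a homeomorphism.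
Invariance of the divergence under bijections moves `e` from `q`, about which no smoothness is
known, to the target: `KL(e#q ‖ P) = KL(q ‖ e⁻¹#P)`. By change of variables `e⁻¹#P` has density `exp
g` relative to `P`, where `g = log p ∘ e - log p + log det De`. The divergence therefore drops by
exactly `∫ g dq`, and `g = ε (D log p · F + tr DF) + O(ε²)` with a `q`-integrable constant
(`klDiv_map_add_smul_expansion`).

The reproducing identity `⟨K_x w, f⟩ = ⟨w, f(x)⟩` and its derivative in `x` rewrite the first-order
term as an inner product with `f` (`inner_steinElement`). This needs `x ↦ K_x w` to be
differentiable into the Hilbert space (`differentiable_of_contDiff_inner`); the kernel bounds make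
`f` and `Df` bounded and the Stein element Bochner integrable. Steepest descent is the equality case
of Cauchy–Schwarz. -/

noncomputable section

namespace SteinProcess

/-! ### Variational characterisation of the Kullback–Leibler divergence -/

section Variational

variable {α : Type*} [MeasurableSpace α]

/-- The Fenchel–Young inequality for `klFun` and its conjugate `t ↦ eᵗ - 1`. -/
theorem mul_sub_exp_le_klFun {x : ℝ} (hx : 0 ≤ x) (t : ℝ) :
    x * t - (Real.exp t - 1) ≤ klFun x := by
  rcases hx.eq_or_lt with rfl | hx
  · simp only [klFun_zero]
    linarith [Real.exp_pos t]
  · have h := Real.add_one_le_exp (t - Real.log x)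
    rw [Real.exp_sub, Real.exp_log hx, le_div_iff₀ hx] at h
    rw [klFun_apply]
    linarith

/-- Along the truncations of `log x`, the Fenchel–Young defect is nonnegative. -/
theorem mul_sub_exp_nonneg {x t : ℝ} (hx : 0 < x)
    (ht : (0 ≤ t ∧ t ≤ Real.log x) ∨ (t ≤ 0 ∧ Real.log x ≤ t)) :
    0 ≤ x * t - (Real.exp t - 1) := by
  have h1 : Real.exp t * (1 - t) ≤ 1 := by
    have := Real.add_one_le_exp (-t)
    calc Real.exp t * (1 - t) ≤ Real.exp t * Real.exp (-t) := by
          apply mul_le_mul_of_nonneg_left _ (Real.exp_pos t).le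
          linarith
      _ = 1 := by rw [← Real.exp_add]; simp
  have h2 : Real.exp t * t ≤ x * t := by
    rcases ht with ⟨h0, h⟩ | ⟨h0, h⟩
    · exact mul_le_mul_of_nonneg_right ((Real.le_log_iff_exp_le hx).1 h) h0
    · exact mul_le_mul_of_nonpos_right ((Real.log_le_iff_le_exp hx).1 h) h0
  linarith

/-- The easy half of the duality: apply Fenchel–Young pointwise to the density and integrate against
`ν`. -/
theorem integral_sub_integral_exp_le_klDiv {μ ν : Measure α} [IsProbabilityMeasure μ]
    [IsProbabilityMeasure ν] (h : klDiv μ ν ≠ ∞) {f : α → ℝ} (hf : Measurable f) {K : ℝ}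
    (hK : ∀ x, |f x| ≤ K) :
    ∫ x, f x ∂μ - ∫ x, (Real.exp (f x) - 1) ∂ν ≤ (klDiv μ ν).toReal := by
  obtain ⟨hac, hint⟩ := klDiv_ne_top_iff.1 h
  rw [toReal_klDiv_eq_integral_klFun hac, ← integral_rnDeriv_smul hac]
  have hi1 : Integrable (fun x => (μ.rnDeriv ν x).toReal • f x) ν := by
    refine (integrable_rnDeriv_smul_iff hac).2 ?_
    exact Integrable.of_bound hf.aestronglyMeasurable K (ae_of_all _ hK)
  have hi2 : Integrable (fun x => Real.exp (f x) - 1) ν := by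
    refine (Integrable.of_bound (C := Real.exp K)
      (Real.measurable_exp.comp hf).aestronglyMeasurable (ae_of_all _ fun x => ?_)).sub
      (integrable_const _)
    simpa using (abs_le.1 (hK x)).2
  rw [← integral_sub hi1 hi2]
  refine integral_mono (hi1.sub hi2) ((integrable_klFun_rnDeriv_iff hac).2 hint) fun x => ?_
  exact mul_sub_exp_le_klFun ENNReal.toReal_nonneg _

/-- The truncation of `log x` at levels `-n` and `n`. -/
def clipLog (n : ℕ) (x : ℝ) : ℝ := max (-n) (min n (if x = 0 then -(n : ℝ) else Real.log x))

theorem measurable_clipLog (n : ℕ) : Measurable (clipLog n) := by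
  unfold clipLog
  refine measurable_const.max (measurable_const.min ?_)
  exact Measurable.ite (measurableSet_singleton 0) measurable_const Real.measurable_log

theorem abs_clipLog_le (n : ℕ) (x : ℝ) : |clipLog n x| ≤ n := by
  have : (0 : ℝ) ≤ n := n.cast_nonneg
  unfold clipLog
  exact abs_le.2 ⟨le_max_left _ _, max_le (by linarith) (min_le_left _ _)⟩

theorem clipLog_defect_nonneg (n : ℕ) {x : ℝ} (hx : 0 ≤ x) :
    0 ≤ x * clipLog n x - (Real.exp (clipLog n x) - 1) := by
  have hn : (0 : ℝ) ≤ n := n.cast_nonneg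
  rcases hx.eq_or_lt with rfl | hx
  · have : Real.exp (clipLog n 0) ≤ 1 := by
      rw [Real.exp_le_one_iff]
      simp [clipLog]
    linarith
  · refine mul_sub_exp_nonneg hx ?_
    simp only [clipLog, hx.ne', if_false]
    rcases le_total 0 (Real.log x) with h | h
    · left
      exact ⟨le_max_of_le_right (le_min hn h), max_le (by linarith) (min_le_right _ _)⟩
    · right
      refine ⟨max_le (by linarith) ((min_le_right _ _).trans h), ?_⟩
      rw [min_eq_right (h.trans hn)]
      exact le_max_right _ _

theorem tendsto_clipLog_defect {x : ℝ} (hx : 0 ≤ x) :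
    Tendsto (fun n : ℕ => x * clipLog n x - (Real.exp (clipLog n x) - 1)) atTop
      (𝓝 (klFun x)) := by
  rcases hx.eq_or_lt with rfl | hx
  -- At `0` the truncation is `-n`, as for `log 0 = -∞`, and not the default value `Real.log 0 = 0`;
  -- the defect `1 - e⁻ⁿ` then tends to `klFun 0 = 1`.
  · have h : ∀ n : ℕ, clipLog n 0 = -(n : ℝ) := fun n => by
      have hn : (0 : ℝ) ≤ n := n.cast_nonneg
      simp only [clipLog, if_true]
      rw [min_eq_right (by linarith), max_self]
    simp only [h, zero_mul, klFun_zero]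
    have : Tendsto (fun n : ℕ => Real.exp (-(n : ℝ))) atTop (𝓝 0) :=
      Real.tendsto_exp_neg_atTop_nhds_zero.comp tendsto_natCast_atTop_atTop
    simpa using (tendsto_const_nhds (x := (0 : ℝ))).sub (this.sub (tendsto_const_nhds (x := (1 : ℝ))))
  · refine tendsto_const_nhds.congr' ?_
    obtain ⟨N, hN⟩ := exists_nat_ge |Real.log x|
    filter_upwards [eventually_ge_atTop N] with n hn
    have hn' : |Real.log x| ≤ n := hN.trans (by exact_mod_cast hn)
    have : clipLog n x = Real.log x := by
      simp only [clipLog, hx.ne', if_false]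
      rw [min_eq_right (abs_le.1 hn').2, max_eq_right (abs_le.1 hn').1]
    rw [this, Real.exp_log hx, klFun_apply]
    ring

/-- Test with `n` times the indicator of a `ν`-null set: the exponential term vanishes, so `n μ(s) ≤
S` for every `n`, which forces `μ(s) = 0`. -/
theorem absolutelyContinuous_of_forall_integral_le {μ ν : Measure α} [IsProbabilityMeasure μ]
    [IsProbabilityMeasure ν] {S : ℝ}
    (h : ∀ f : α → ℝ, Measurable f → (∃ K, ∀ x, |f x| ≤ K) →
      ∫ x, f x ∂μ - ∫ x, (Real.exp (f x) - 1) ∂ν ≤ S) : μ ≪ ν := by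
  refine Measure.AbsolutelyContinuous.mk fun s hs hνs => ?_
  by_contra hμ
  have hpos : 0 < μ.real s := ENNReal.toReal_pos hμ (measure_ne_top _ _)
  obtain ⟨n, hn⟩ := exists_nat_gt (S / μ.real s)
  rw [div_lt_iff₀ hpos] at hn
  have h1 := h (s.indicator fun _ => (n : ℝ)) (measurable_const.indicator hs) ⟨n, fun x => by
    by_cases hx : x ∈ s <;> simp [hx]⟩
  have h2 : ∫ x, (Real.exp (s.indicator (fun _ => (n : ℝ)) x) - 1) ∂ν = 0 := by
    refine integral_eq_zero_of_ae ?_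
    filter_upwards [measure_eq_zero_iff_ae_notMem.1 hνs] with x hx
    simp [hx]
  rw [h2, integral_indicator_const _ hs, smul_eq_mul, sub_zero] at h1
  linarith

/-- The variational upper bound for the Kullback–Leibler divergence: it suffices to test with
bounded measurable functions. -/
theorem klDiv_le_of_forall_integral_le {μ ν : Measure α} [IsProbabilityMeasure μ]
    [IsProbabilityMeasure ν] {S : ℝ}
    (h : ∀ f : α → ℝ, Measurable f → (∃ K, ∀ x, |f x| ≤ K) →
      ∫ x, f x ∂μ - ∫ x, (Real.exp (f x) - 1) ∂ν ≤ S) :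
    klDiv μ ν ≤ ENNReal.ofReal S := by
  have hac := absolutelyContinuous_of_forall_integral_le h
  rw [klDiv_eq_lintegral_klFun_of_ac hac]
  set r : α → ℝ := fun x => (μ.rnDeriv ν x).toReal with hr
  have hrm : Measurable r := (Measure.measurable_rnDeriv μ ν).ennreal_toReal
  have hr0 : ∀ x, 0 ≤ r x := fun x => ENNReal.toReal_nonneg
  set F : ℕ → α → ℝ := fun n x => r x * clipLog n (r x) - (Real.exp (clipLog n (r x)) - 1) with hF
  have hcm : ∀ n, Measurable fun x => clipLog n (r x) := fun n => (measurable_clipLog n).comp hrm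
  have hFm : ∀ n, Measurable (F n) := fun n =>
    (hrm.mul (hcm n)).sub ((Real.measurable_exp.comp (hcm n)).sub measurable_const)
  have hlim : ∀ x, Tendsto (fun n => ENNReal.ofReal (F n x)) atTop
      (𝓝 (ENNReal.ofReal (klFun (r x)))) := fun x =>
    ENNReal.tendsto_ofReal (tendsto_clipLog_defect (hr0 x))
  have hle : ∀ n, ∫⁻ x, ENNReal.ofReal (F n x) ∂ν ≤ ENNReal.ofReal S := fun n => by
    have hi1 : Integrable (fun x => r x • clipLog n (r x)) ν := by
      refine (integrable_rnDeriv_smul_iff hac).2 ?_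
      exact Integrable.of_bound (hcm n).aestronglyMeasurable n
        (ae_of_all _ fun x => abs_clipLog_le n _)
    have hi2 : Integrable (fun x => Real.exp (clipLog n (r x)) - 1) ν := by
      refine (Integrable.of_bound (C := Real.exp n)
        (Real.measurable_exp.comp (hcm n)).aestronglyMeasurable (ae_of_all _ fun x => ?_)).sub
        (integrable_const _)
      simpa using (abs_le.1 (abs_clipLog_le n (r x))).2
    have hi : ∫ x, F n x ∂ν ≤ S := by
      have := h (fun x => clipLog n (r x)) (hcm n) ⟨n, fun x => abs_clipLog_le n _⟩
      rw [← integral_rnDeriv_smul hac, ← integral_sub hi1 hi2] at this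
      exact this
    have hFi : Integrable (F n) ν := hi1.sub hi2
    rw [← ofReal_integral_eq_lintegral_ofReal hFi
      (ae_of_all _ fun x => clipLog_defect_nonneg n (hr0 x))]
    exact ENNReal.ofReal_le_ofReal hi
  -- Fatou's lemma: the truncated logarithms of the density are admissible test functions, their
  -- defects are nonnegative, and these converge pointwise to `klFun`.
  calc ∫⁻ x, ENNReal.ofReal (klFun (r x)) ∂ν
      = ∫⁻ x, liminf (fun n => ENNReal.ofReal (F n x)) atTop ∂ν :=
        lintegral_congr fun x => (hlim x).liminf_eq.symm
    _ ≤ liminf (fun n => ∫⁻ x, ENNReal.ofReal (F n x) ∂ν) atTop :=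
        lintegral_liminf_le fun n => (hFm n).ennreal_ofReal
    _ ≤ ENNReal.ofReal S := liminf_le_of_le (by isBoundedDefault) fun b hb => by
        obtain ⟨n, hn⟩ := hb.exists
        exact hn.trans (hle n)

end Variational

/-! ### Density of cylinder functions in `L¹` -/

section Cylinder

variable {ι : Type*} {β : ι → Type*} [∀ i, MeasurableSpace (β i)]

/-- Integrable functions on a product space are approximated in `L¹` by functions of finitely
many coordinates. -/
theorem exists_cylinder_eLpNorm_sub_le (ρ : Measure (∀ i, β i)) [IsFiniteMeasure ρ]
    {f : (∀ i, β i) → ℝ} (hf : MemLp f 1 ρ) {ε : ℝ≥0∞} (hε : ε ≠ 0) :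
    ∃ g, eLpNorm (f - g) 1 ρ ≤ ε ∧
      ∃ (s : Finset ι) (g₀ : (∀ i : s, β i) → ℝ), Measurable g₀ ∧ g = g₀ ∘ s.restrict := by
  classical
  refine MemLp.induction_dense ENNReal.one_ne_top _ ?_ ?_ ?_ hf hε
  · intro c s hs _ ε hε
    -- Measurable cylinders form an algebra generating the product `σ`-algebra, so they approximate
    -- every measurable set in measure.
    have hd := Measure.MeasureDense.of_generateFrom_isSetAlgebra_finite (μ := ρ)
      (isSetAlgebra_measurableCylinders (α := β)) generateFrom_measurableCylinders.symm
    obtain ⟨η, hη, hηε⟩ : ∃ η : ℝ, 0 < η ∧ ‖c‖ₑ * ENNReal.ofReal η ≤ ε := by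
      have : Tendsto (fun η : ℝ => ‖c‖ₑ * ENNReal.ofReal η) (𝓝[>] 0) (𝓝 (‖c‖ₑ * 0)) := by
        refine ENNReal.Tendsto.const_mul ?_ (Or.inr enorm_ne_top)
        have := (ENNReal.continuous_ofReal.tendsto 0).mono_left
          (nhdsWithin_le_nhds (s := Set.Ioi (0 : ℝ)))
        simpa using this
      rw [mul_zero] at this
      obtain ⟨η, h1, h2⟩ := ((this.eventually (ge_mem_nhds hε.bot_lt)).and
        self_mem_nhdsWithin).exists
      exact ⟨η, h2, h1⟩
    obtain ⟨t, ht, hst⟩ := hd.approx s hs (measure_ne_top _ _) η hη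
    obtain ⟨I, T, hT, rfl⟩ := (mem_measurableCylinders t).1 ht
    refine ⟨_, ?_, I, T.indicator fun _ => c, measurable_const.indicator hT, rfl⟩
    have heq : (T.indicator fun _ => c) ∘ I.restrict
        = (cylinder I T).indicator (fun _ => c) := rfl
    rw [heq, eLpNorm_indicator_sub_indicator, eLpNorm_indicator_const
      (((MeasurableSet.cylinder I hT).symmDiff hs)) one_ne_zero ENNReal.one_ne_top]
    simp only [ENNReal.toReal_one, div_one, ENNReal.rpow_one]
    rw [symmDiff_comm]
    exact (mul_le_mul_right hst.le _).trans hηε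
  · rintro f g ⟨s, f₀, hf₀, rfl⟩ ⟨t, g₀, hg₀, rfl⟩
    refine ⟨s ∪ t, fun x => f₀ (Finset.restrict₂ Finset.subset_union_left x)
      + g₀ (Finset.restrict₂ Finset.subset_union_right x),
      (hf₀.comp (Finset.measurable_restrict₂ _)).add
        (hg₀.comp (Finset.measurable_restrict₂ _)), rfl⟩
  · rintro _ ⟨s, f₀, hf₀, rfl⟩
    exact (hf₀.comp (Finset.measurable_restrict s)).aestronglyMeasurable

end Cylinder

/-! ### The divergence of processes as a supremum over finite marginals -/

theorem abs_exp_sub_exp_le {a b K : ℝ} (ha : a ≤ K) (hb : b ≤ K) :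
    |Real.exp a - Real.exp b| ≤ Real.exp K * |a - b| := by
  have key : ∀ {a b : ℝ}, a ≤ K → b ≤ K → Real.exp a - Real.exp b ≤ Real.exp K * |a - b| := by
    intro a b ha _
    have h1 := Real.add_one_le_exp (b - a)
    have h2 : Real.exp a - Real.exp b ≤ Real.exp a * (a - b) := by
      have : Real.exp b = Real.exp a * Real.exp (b - a) := by rw [← Real.exp_add]; ring_nf
      rw [this]
      nlinarith [Real.exp_pos a]
    calc _ ≤ _ := h2
      _ ≤ Real.exp a * |a - b| := by gcongr; exact le_abs_self _
      _ ≤ _ := by gcongr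
  rw [abs_le]
  refine ⟨?_, key ha hb⟩
  have := key hb ha
  rw [abs_sub_comm] at this
  linarith

theorem abs_clip_sub_le {x y K : ℝ} (hx : |x| ≤ K) : |x - max (-K) (min K y)| ≤ |x - y| := by
  have h := abs_le.1 hx
  rcases le_total y K with h1 | h1
  · rw [min_eq_right h1]
    rcases le_total (-K) y with h2 | h2
    · rw [max_eq_right h2]
    · rw [max_eq_left h2, abs_of_nonneg (by linarith), abs_of_nonneg (by linarith)]
      linarith
  · rw [min_eq_left h1, max_eq_right (by linarith [abs_nonneg x]), abs_of_nonpos (by linarith),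
      abs_of_nonpos (by linarith)]
    linarith

theorem measurable_evalAt {n d : ℕ} (Ω : Mat n d) : Measurable (evalAt Ω) :=
  measurable_pi_lambda _ fun i => measurable_pi_apply (Ω i)

instance {n d : ℕ} (Ω : Mat n d) (Q : Measure (Fun d)) [IsProbabilityMeasure Q] :
    IsProbabilityMeasure (marginal Ω Q) :=
  Measure.isProbabilityMeasure_map (measurable_evalAt Ω).aemeasurable

/-- Enumerating `s` yields a matrix of inputs from whose values the restriction to `s` is read off;
conclude by data processing. -/
theorem klDiv_map_restrict_le_marginalKLSup {d : ℕ} (Q P : Measure (Fun d))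
    [IsProbabilityMeasure Q] [IsProbabilityMeasure P] (s : Finset (Pt d)) :
    klDiv (Q.map s.restrict) (P.map s.restrict) ≤ marginalKLSup Q P := by
  let Ω : Mat s.card d := fun i => s.equivFin.symm i
  let φ : Mat s.card d → (∀ _ : s, Pt d) := fun M x => M (s.equivFin x)
  have hφ : Measurable φ := measurable_pi_lambda _ fun x => measurable_pi_apply _
  have hcomp : φ ∘ evalAt Ω = s.restrict := by
    ext h x
    simp [φ, Ω, evalAt]
  have hmap : ∀ μ : Measure (Fun d), μ.map s.restrict = (marginal Ω μ).map φ := fun μ => by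
    rw [marginal, Measure.map_map hφ (measurable_evalAt Ω), hcomp]
  rw [hmap, hmap]
  exact (klDiv_map_le _ _ hφ).trans (le_iSup₂_of_le s.card Ω le_rfl)

theorem marginalKLSup_le_klDiv {d : ℕ} (Q P : Measure (Fun d))
    [IsProbabilityMeasure Q] [IsProbabilityMeasure P] : marginalKLSup Q P ≤ klDiv Q P :=
  iSup₂_le fun _ Ω => klDiv_map_le _ _ (measurable_evalAt Ω)

/-- The Kullback–Leibler divergence between two processes is the supremum of the divergences
between their finite-dimensional marginals. -/
theorem klDiv_eq_marginalKLSup {d : ℕ} (Q P : Measure (Fun d))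
    [IsProbabilityMeasure Q] [IsProbabilityMeasure P] : klDiv Q P = marginalKLSup Q P := by
  refine le_antisymm ?_ (marginalKLSup_le_klDiv Q P)
  by_cases htop : marginalKLSup Q P = ∞
  · rw [htop]; exact le_top
  rw [← ENNReal.ofReal_toReal htop]
  refine klDiv_le_of_forall_integral_le fun f hf ⟨K, hK⟩ => ?_
  refine le_of_forall_pos_le_add fun ε hε => ?_
  -- An `L¹(Q + P)` error `ε / c` costs at most itself in the linear term and `exp K` times itself
  -- in the exponential term, hence at most `ε` in all.
  set c : ℝ := 1 + Real.exp K with hc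
  have hc0 : 0 < c := by positivity
  have hfL : MemLp f 1 (Q + P) :=
    MemLp.of_bound hf.aestronglyMeasurable K (ae_of_all _ hK)
  obtain ⟨_, hg, s, g₀, hg₀, rfl⟩ := exists_cylinder_eLpNorm_sub_le (Q + P) hfL
    (ε := ENNReal.ofReal (ε / c)) (by simpa using div_pos hε hc0)
  have hsm : Measurable (s.restrict : Fun d → _) := Finset.measurable_restrict s
  -- Since `|f| ≤ K`, truncating the approximant at `±K` brings it no further from `f`, and makes it
  -- an admissible test function.
  set u : (∀ _ : s, Pt d) → ℝ := fun x => max (-K) (min K (g₀ x)) with hu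
  have hK0 : 0 ≤ K := (abs_nonneg _).trans (hK 0)
  have hum : Measurable u := measurable_const.max (measurable_const.min hg₀)
  have hub : ∀ x, |u x| ≤ K := fun x =>
    abs_le.2 ⟨le_max_left _ _, max_le (by linarith) (min_le_left _ _)⟩
  have hQs : IsProbabilityMeasure (Q.map s.restrict) :=
    Measure.isProbabilityMeasure_map hsm.aemeasurable
  have hPs : IsProbabilityMeasure (P.map s.restrict) :=
    Measure.isProbabilityMeasure_map hsm.aemeasurable
  have hle := klDiv_map_restrict_le_marginalKLSup Q P s
  have hkl := integral_sub_integral_exp_le_klDiv (ne_top_of_le_ne_top htop hle) hum hub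
  have hkl' := hkl.trans (ENNReal.toReal_mono htop hle)
  have hem : Measurable fun x => Real.exp (u x) - 1 :=
    (Real.measurable_exp.comp hum).sub measurable_const
  rw [integral_map hsm.aemeasurable hum.aestronglyMeasurable,
    integral_map hsm.aemeasurable hem.aestronglyMeasurable] at hkl'
  set v : Fun d → ℝ := fun h => u (s.restrict h) with hv
  have hvm : Measurable v := hum.comp hsm
  have hbi : ∀ (μ : Measure (Fun d)) [IsProbabilityMeasure μ] (w : Fun d → ℝ), Measurable w →
      (∀ x, |w x| ≤ K) → Integrable w μ ∧ Integrable (fun x => Real.exp (w x) - 1) μ := by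
    intro μ _ w hw hwK
    refine ⟨Integrable.of_bound hw.aestronglyMeasurable K (ae_of_all _ hwK),
      (Integrable.of_bound (C := Real.exp K) (Real.measurable_exp.comp hw).aestronglyMeasurable
        (ae_of_all _ fun x => ?_)).sub (integrable_const _)⟩
    simpa using (abs_le.1 (hwK x)).2
  have hdiff : Integrable (fun h => |f h - v h|) Q ∧ Integrable (fun h => |f h - v h|) P :=
    ⟨((hbi Q f hf hK).1.sub (hbi Q v hvm fun x => hub _).1).abs,
      ((hbi P f hf hK).1.sub (hbi P v hvm fun x => hub _).1).abs⟩
  have hdm : Measurable fun h => |f h - v h| := (hf.sub hvm).norm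
  have hsum : ∫ h, |f h - v h| ∂Q + ∫ h, |f h - v h| ∂P ≤ ε / c := by
    rw [← integral_add_measure hdiff.1 hdiff.2, integral_eq_lintegral_of_nonneg_ae
      (ae_of_all _ fun _ => abs_nonneg _) hdm.aestronglyMeasurable]
    refine ENNReal.toReal_le_of_le_ofReal (by positivity) (le_trans ?_ hg)
    rw [eLpNorm_one_eq_lintegral_enorm]
    refine lintegral_mono fun h => ?_
    rw [Real.enorm_eq_ofReal_abs]
    exact ENNReal.ofReal_le_ofReal (abs_clip_sub_le (hK h))
  have hQ : ∫ h, f h ∂Q - ∫ h, v h ∂Q ≤ ∫ h, |f h - v h| ∂Q := by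
    rw [← integral_sub (hbi Q f hf hK).1 (hbi Q v hvm fun x => hub _).1]
    exact integral_mono ((hbi Q f hf hK).1.sub (hbi Q v hvm fun x => hub _).1) hdiff.1
      fun x => le_abs_self _
  have hP : ∫ h, (Real.exp (v h) - 1) ∂P - ∫ h, (Real.exp (f h) - 1) ∂P
      ≤ Real.exp K * ∫ h, |f h - v h| ∂P := by
    rw [← integral_sub (hbi P v hvm fun x => hub _).2 (hbi P f hf hK).2, ← integral_const_mul]
    refine integral_mono ((hbi P v hvm fun x => hub _).2.sub (hbi P f hf hK).2)
      (hdiff.2.const_mul _) fun x => ?_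
    have := abs_exp_sub_exp_le (abs_le.1 (hub (s.restrict x))).2 (abs_le.1 (hK x)).2
    have h2 := (le_abs_self _).trans this
    rw [abs_sub_comm] at h2
    simp only [sub_sub_sub_cancel_right]
    exact h2
  have hfin : ∫ h, |f h - v h| ∂Q + Real.exp K * ∫ h, |f h - v h| ∂P ≤ ε := by
    have h1 : 0 ≤ ∫ h, |f h - v h| ∂Q := integral_nonneg fun _ => abs_nonneg _
    have h2 : 0 ≤ ∫ h, |f h - v h| ∂P := integral_nonneg fun _ => abs_nonneg _
    have h3 := mul_le_mul_of_nonneg_left hsum hc0.le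
    rw [mul_div_cancel₀ _ hc0.ne'] at h3
    nlinarith [Real.exp_pos K]
  linarith

/-! ### Differentiability of Hilbert-space maps with a `C²` Gram kernel -/

section FeatureMap

variable {E : Type*} [NormedAddCommGroup E] [NormedSpace ℝ E]

set_option maxSynthPendingDepth 3 in
/-- The mixed second difference of a `C²` function of two variables is, to leading order, a
bilinear form in the increments. -/
theorem exists_bilin_second_difference {K : E × E → ℝ} (hK : ContDiff ℝ 2 K) (x : E) :
    ∃ B : E →L[ℝ] E →L[ℝ] ℝ, ∀ ε > 0, ∃ δ > 0, ∀ h k, ‖h‖ < δ → ‖k‖ < δ →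
      |K (x + h, x + k) - K (x + h, x) - K (x, x + k) + K (x, x) - B k h| ≤ ε * ‖h‖ * ‖k‖ := by
  have hK1 : ContDiff ℝ 1 (fderiv ℝ K) := hK.fderiv_right (m := 1) (by norm_num)
  -- `D` is the derivative in the first variable and `J` that of `D` in the second. The mean value
  -- inequality is used once in each variable, with `J` within `ε` of its value at `(x, x)`.
  let D : E × E → E →L[ℝ] ℝ := fun z => (fderiv ℝ K z).comp (ContinuousLinearMap.inl ℝ E E)
  have hD : ContDiff ℝ 1 D := hK1.clm_comp contDiff_const
  let J : E × E → E →L[ℝ] E →L[ℝ] ℝ :=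
    fun z => (fderiv ℝ D z).comp (ContinuousLinearMap.inr ℝ E E)
  have hJ : Continuous J := (hD.continuous_fderiv one_ne_zero).clm_comp continuous_const
  refine ⟨J (x, x), fun ε hε => ?_⟩
  have hJn : Continuous fun z => ‖J z - J (x, x)‖ := (hJ.sub continuous_const).norm
  have hev : ∀ᶠ z in 𝓝 (x, x), ‖J z - J (x, x)‖ < ε :=
    hJn.continuousAt.eventually_lt continuousAt_const (by simpa using hε)
  obtain ⟨δ, hδ, hball⟩ := Metric.eventually_nhds_iff.1 hev
  refine ⟨δ, hδ, fun h k hh hk => ?_⟩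
  have hJε : ∀ a b : E, ‖a‖ < δ → ‖b‖ < δ → ‖J (x + a, x + b) - J (x, x)‖ ≤ ε := by
    intro a b ha hb
    refine (hball ?_).le
    simpa [Prod.dist_eq] using ⟨ha, hb⟩
  have hdK : ∀ a b : E, HasFDerivAt (fun a => K (x + a, x + b)) (D (x + a, x + b)) a := by
    intro a b
    have h1 := (hK.differentiable two_ne_zero (x + a, x + b)).hasFDerivAt
    have h2 : HasFDerivAt (fun a : E => (x + a, x + b)) (ContinuousLinearMap.inl ℝ E E) a :=
      ((hasFDerivAt_id a).const_add x).prodMk (hasFDerivAt_const (x + b) a)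
    exact h1.comp a h2
  have hdD : ∀ a b : E, HasFDerivAt (fun b => D (x + a, x + b)) (J (x + a, x + b)) b := by
    intro a b
    have h1 := (hD.differentiable one_ne_zero (x + a, x + b)).hasFDerivAt
    have h2 : HasFDerivAt (fun b : E => (x + a, x + b)) (ContinuousLinearMap.inr ℝ E E) b :=
      (hasFDerivAt_const (x + a) b).prodMk ((hasFDerivAt_id b).const_add x)
    exact h1.comp b h2
  have h0 : (0 : E) ∈ Metric.ball (0 : E) δ := Metric.mem_ball_self hδ
  have step1 : ∀ a : E, ‖a‖ < δ → ‖D (x + a, x + k) - D (x + a, x) - J (x, x) k‖ ≤ ε * ‖k‖ := by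
    intro a ha
    have := (convex_ball (0 : E) δ).norm_image_sub_le_of_norm_hasFDerivWithin_le'
      (f := fun b => D (x + a, x + b)) (φ := J (x, x)) (C := ε)
      (fun b _ => (hdD a b).hasFDerivWithinAt)
      (fun b hb => hJε a b ha (mem_ball_zero_iff.1 hb)) h0 (mem_ball_zero_iff.2 hk)
    simpa using this
  have := (convex_ball (0 : E) δ).norm_image_sub_le_of_norm_hasFDerivWithin_le'
      (f := fun a => K (x + a, x + k) - K (x + a, x + 0)) (φ := J (x, x) k) (C := ε * ‖k‖)
      (fun a _ => ((hdK a k).sub (hdK a 0)).hasFDerivWithinAt)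
      (fun a ha => by simpa using step1 a (mem_ball_zero_iff.1 ha)) h0 (mem_ball_zero_iff.2 hh)
  simp only [sub_zero, add_zero, Real.norm_eq_abs] at this
  calc _ = |K (x + h, x + k) - K (x + h, x) - (K (x, x + k) - K (x, x)) - J (x, x) k h| := by
        congr 1; ring
    _ ≤ _ := this
    _ = _ := by ring

variable {H : Type*} [NormedAddCommGroup H] [InnerProductSpace ℝ H]

/-- The factors `s` and `t` cancel, so the bound is uniform in the step sizes. In particular `s = 1`
compares a full increment with arbitrarily short difference quotients. -/
theorem abs_inner_increment_sub_le {Ψ : E → H} {x : E} {B : E →L[ℝ] E →L[ℝ] ℝ} {ε δ : ℝ}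
    (hB : ∀ h k, ‖h‖ < δ → ‖k‖ < δ →
      |inner ℝ (Ψ (x + h) - Ψ x) (Ψ (x + k) - Ψ x) - B k h| ≤ ε * ‖h‖ * ‖k‖)
    {u v : E} (hu : ‖u‖ < δ) (hv : ‖v‖ < δ) {s t : ℝ} (hs : 0 < |s| ∧ |s| ≤ 1)
    (ht : 0 < |t| ∧ |t| ≤ 1) :
    |inner ℝ (s⁻¹ • (Ψ (x + s • u) - Ψ x)) (t⁻¹ • (Ψ (x + t • v) - Ψ x)) - B v u|
      ≤ ε * ‖u‖ * ‖v‖ := by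
  have hlt : ∀ {r : ℝ} {w : E}, ‖w‖ < δ → |r| ≤ 1 → ‖r • w‖ < δ := fun {r w} hw hr => by
    rw [norm_smul, Real.norm_eq_abs]
    exact (mul_le_of_le_one_left (norm_nonneg _) hr).trans_lt hw
  have hs0 : s ≠ 0 := abs_pos.1 hs.1
  have ht0 : t ≠ 0 := abs_pos.1 ht.1
  have h := hB (s • u) (t • v) (hlt hu hs.2) (hlt hv ht.2)
  have e1 : inner ℝ (s⁻¹ • (Ψ (x + s • u) - Ψ x)) (t⁻¹ • (Ψ (x + t • v) - Ψ x)) - B v u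
      = s⁻¹ * t⁻¹ * (inner ℝ (Ψ (x + s • u) - Ψ x) (Ψ (x + t • v) - Ψ x)
        - B (t • v) (s • u)) := by
    rw [real_inner_smul_left, real_inner_smul_right]
    simp only [map_smul, smul_eq_mul, smul_apply]
    field_simp
  rw [e1, abs_mul, abs_mul, abs_inv, abs_inv]
  calc |s|⁻¹ * |t|⁻¹ * _ ≤ |s|⁻¹ * |t|⁻¹ * (ε * ‖s • u‖ * ‖t • v‖) := by gcongr
    _ = ε * ‖u‖ * ‖v‖ := by
      rw [norm_smul, norm_smul, Real.norm_eq_abs, Real.norm_eq_abs]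
      have := hs.1.ne'
      have := ht.1.ne'
      field_simp

/-- Expanding the square cancels `c`: vectors whose mutual inner products nearly agree are close in
norm. -/
theorem norm_sub_sq_le_of_inner {a b : H} {c η : ℝ} (haa : |inner ℝ a a - c| ≤ η)
    (hab : |inner ℝ a b - c| ≤ η) (hbb : |inner ℝ b b - c| ≤ η) : ‖a - b‖ ^ 2 ≤ 4 * η := by
  rw [norm_sub_sq_real, ← real_inner_self_eq_norm_sq, ← real_inner_self_eq_norm_sq]
  rw [abs_le] at *
  linarith [haa.2, hab.1, hbb.2]

/-- A map into a Hilbert space whose Gram kernel is `C²` is Fréchet differentiable. -/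
theorem differentiable_of_contDiff_inner [FiniteDimensional ℝ E] [CompleteSpace H] {Ψ : E → H}
    (hΨ : ContDiff ℝ 2 fun z : E × E => inner ℝ (Ψ z.1) (Ψ z.2)) : Differentiable ℝ Ψ := by
  intro x
  obtain ⟨B, hB⟩ := exists_bilin_second_difference hΨ x
  have hB' : ∀ ε > 0, ∃ δ > 0, ∀ h k, ‖h‖ < δ → ‖k‖ < δ →
      |inner ℝ (Ψ (x + h) - Ψ x) (Ψ (x + k) - Ψ x) - B k h| ≤ ε * ‖h‖ * ‖k‖ := by
    intro ε hε
    obtain ⟨δ, hδ, h⟩ := hB ε hε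
    refine ⟨δ, hδ, fun a b ha hb => ?_⟩
    have := h a b ha hb
    rw [inner_sub_left, inner_sub_right, inner_sub_right]
    convert this using 2
    ring
  let q : E → ℝ → H := fun v t => t⁻¹ • (Ψ (x + t • v) - Ψ x)
  have hq : ∀ u v : E, ∀ η > 0, ∃ τ > 0, ∀ s t : ℝ, 0 < |s| → |s| < τ → 0 < |t| → |t| < τ →
      |inner ℝ (q u s) (q v t) - B v u| ≤ η := by
    intro u v η hη
    -- Adding `1` keeps `c` positive when `u` or `v` vanishes.
    set c := (‖u‖ + 1) * (‖v‖ + 1) with hc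
    have hc0 : 0 < c := by positivity
    obtain ⟨δ, hδ, hb⟩ := hB' (η / c) (by positivity)
    refine ⟨δ / (‖u‖ + ‖v‖ + 1), by positivity, fun s t hs hs' ht ht' => ?_⟩
    have key : ∀ {r : ℝ} {w : E}, ‖w‖ ≤ ‖u‖ + ‖v‖ + 1 → |r| < δ / (‖u‖ + ‖v‖ + 1) →
        ‖r • w‖ < δ := fun {r w} hw hr => by
      rw [norm_smul, Real.norm_eq_abs]
      calc |r| * ‖w‖ ≤ |r| * (‖u‖ + ‖v‖ + 1) := by gcongr
        _ < δ := (lt_div_iff₀ (by positivity)).1 hr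
    have hu := norm_nonneg u
    have hv := norm_nonneg v
    have h1 := hb (s • u) (t • v) (key (by linarith) hs') (key (by linarith) ht')
    have hs0 : s ≠ 0 := abs_pos.1 hs
    have ht0 : t ≠ 0 := abs_pos.1 ht
    have e1 : inner ℝ (q u s) (q v t) - B v u = s⁻¹ * t⁻¹ *
        (inner ℝ (Ψ (x + s • u) - Ψ x) (Ψ (x + t • v) - Ψ x) - B (t • v) (s • u)) := by
      simp only [q]
      rw [real_inner_smul_left, real_inner_smul_right]
      simp only [map_smul, smul_eq_mul, smul_apply]
      field_simp
    rw [e1, abs_mul, abs_mul, abs_inv, abs_inv]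
    calc |s|⁻¹ * |t|⁻¹ * _ ≤ |s|⁻¹ * |t|⁻¹ * (η / c * ‖s • u‖ * ‖t • v‖) := by gcongr
      _ = η / c * (‖u‖ * ‖v‖) := by
        rw [norm_smul, norm_smul, Real.norm_eq_abs, Real.norm_eq_abs]
        have := hs.ne'
        have := ht.ne'
        field_simp
      _ ≤ η / c * c := by
        gcongr
        rw [hc]
        gcongr <;> linarith
      _ = η := by field_simp
  -- Inner products of difference quotients converge to `B`, so the quotients are Cauchy in norm and
  -- completeness supplies the limit.
  have hlim : ∀ v, ∃ y, Tendsto (q v) (𝓝[≠] 0) (𝓝 y) := by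
    intro v
    refine cauchy_map_iff_exists_tendsto.1 ?_
    rw [Metric.cauchy_iff]
    refine ⟨by infer_instance, fun η hη => ?_⟩
    obtain ⟨τ, hτ, h⟩ := hq v v (η ^ 2 / 5) (by positivity)
    refine ⟨_, image_mem_map (inter_mem_nhdsWithin {0}ᶜ (Metric.ball_mem_nhds 0 hτ)), ?_⟩
    rintro _ ⟨s, ⟨hs0, hs⟩, rfl⟩ _ ⟨t, ⟨ht0, ht⟩, rfl⟩
    have hs0 : 0 < |s| := abs_pos.2 hs0
    have ht0 : 0 < |t| := abs_pos.2 ht0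
    rw [mem_ball_zero_iff, Real.norm_eq_abs] at hs ht
    have := norm_sub_sq_le_of_inner (h s s hs0 hs hs0 hs) (h s t hs0 hs ht0 ht)
      (h t t ht0 ht ht0 ht)
    rw [dist_eq_norm]
    refine lt_of_pow_lt_pow_left₀ 2 hη.le ?_
    have : 0 < η ^ 2 := by positivity
    linarith
  choose D hD using hlim
  have hinner : ∀ u v, inner ℝ (D u) (D v) = B v u := by
    intro u v
    have h1 : Tendsto (fun t => inner ℝ (q u t) (q v t)) (𝓝[≠] 0) (𝓝 (inner ℝ (D u) (D v))) :=
      (hD u).inner (hD v)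
    refine tendsto_nhds_unique h1 (Metric.tendsto_nhds.2 fun η hη => ?_)
    obtain ⟨τ, hτ, h⟩ := hq u v (η / 2) (by positivity)
    filter_upwards [inter_mem_nhdsWithin {0}ᶜ (Metric.ball_mem_nhds 0 hτ)] with t ht
    have ht0 : 0 < |t| := abs_pos.2 ht.1
    have ht1 : |t| < τ := by simpa using ht.2
    rw [Real.dist_eq]
    linarith [h t t ht0 ht1 ht0 ht1]
  -- Linearity comes from bilinearity of `B`: the squared norm of the defect is a combination of
  -- values of `B` that cancels.
  have hadd : ∀ u v, D (u + v) = D u + D v := by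
    intro u v
    rw [← sub_eq_zero, ← inner_self_eq_zero (𝕜 := ℝ)]
    simp only [inner_sub_left, inner_sub_right, inner_add_left, inner_add_right, hinner,
      map_add, add_apply]
    ring
  have hsmul : ∀ (c : ℝ) u, D (c • u) = c • D u := by
    intro c u
    rw [← sub_eq_zero, ← inner_self_eq_zero (𝕜 := ℝ)]
    simp only [inner_sub_left, inner_sub_right, real_inner_smul_left, real_inner_smul_right,
      hinner, map_smul, smul_apply, smul_eq_mul]
    ring
  let L : E →ₗ[ℝ] H := ⟨⟨D, hadd⟩, hsmul⟩
  refine ⟨L.toContinuousLinearMap, ?_⟩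
  rw [hasFDerivAt_iff_isLittleO_nhds_zero, isLittleO_iff]
  intro η hη
  obtain ⟨δ, hδ, hb⟩ := hB' (η ^ 2 / 4) (by positivity)
  filter_upwards [Metric.ball_mem_nhds 0 hδ] with h hh
  rw [mem_ball_zero_iff] at hh
  -- `q h 1` is the increment itself. The estimate is uniform in `t`, so letting `t → 0` replaces `q
  -- h t` by `D h`.
  have hle : ∀ᶠ t in 𝓝[≠] (0 : ℝ), ‖q h 1 - q h t‖ ≤ η * ‖h‖ := by
    filter_upwards [inter_mem_nhdsWithin {0}ᶜ (Metric.ball_mem_nhds 0 one_pos)] with t ht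
    have ht0 : 0 < |t| := abs_pos.2 ht.1
    have ht1 : |t| < 1 := by simpa using ht.2
    have h11 : 0 < |(1 : ℝ)| ∧ |(1 : ℝ)| ≤ 1 := by simp
    have := norm_sub_sq_le_of_inner
      (abs_inner_increment_sub_le hb hh hh h11 h11)
      (abs_inner_increment_sub_le hb hh hh h11 ⟨ht0, ht1.le⟩)
      (abs_inner_increment_sub_le hb hh hh ⟨ht0, ht1.le⟩ ⟨ht0, ht1.le⟩)
    refine le_of_sq_le_sq ?_ (by positivity)
    calc _ ≤ _ := this
      _ = _ := by ring
  have hfin : ‖q h 1 - D h‖ ≤ η * ‖h‖ :=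
    le_of_tendsto ((tendsto_const_nhds.sub (hD h)).norm) hle
  simpa [q, L] using hfin

end FeatureMap

/-! ### Second-order expansion of the log-determinant -/

section LogDet

variable {V : Type*} [NormedAddCommGroup V] [NormedSpace ℝ V] [FiniteDimensional ℝ V]

theorem contDiff_det {n : WithTop ℕ∞} : ContDiff ℝ n fun B : V →L[ℝ] V => B.det := by
  classical
  let b := Module.finBasis ℝ V
  have h : (fun B : V →L[ℝ] V => B.det) = fun B => ∑ σ : Equiv.Perm (Fin (Module.finrank ℝ V)),
      ((Equiv.Perm.sign σ : ℤ) : ℝ) * ∏ i, (b.coord (σ i)).toContinuousLinearMap (B (b i)) := by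
    ext B
    rw [ContinuousLinearMap.det, ← LinearMap.det_toMatrix b, Matrix.det_apply']
    simp [LinearMap.toMatrix_apply]
  rw [h]
  refine ContDiff.sum fun σ _ => contDiff_const.mul (contDiff_prod fun i _ => ?_)
  exact (ContinuousLinearMap.contDiff _).comp (contDiff_id.clm_apply contDiff_const)

/-- In a basis, `det (1 + tM)` is a polynomial in `t` of the form `1 + t tr M + t² r(t)`. -/
theorem hasDerivAt_det_one_add_smul (B : V →L[ℝ] V) :
    HasDerivAt (fun t : ℝ => (1 + t • B).det) (LinearMap.trace ℝ V B) 0 := by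
  classical
  let b := Module.finBasis ℝ V
  let M := LinearMap.toMatrix b b B
  have h : (fun t : ℝ => (1 + t • B).det) = fun t => 1 + M.trace * t +
      (Matrix.det (1 + (Polynomial.X : Polynomial ℝ) • M.map Polynomial.C)).divX.divX.eval t
        * t ^ 2 := by
    ext t
    rw [← Matrix.det_one_add_smul, ContinuousLinearMap.det, ← LinearMap.det_toMatrix b]
    congr 1
    simp only [M, ← LinearMap.toMatrix_one b, ← map_smul, ← map_add]
    rfl
  rw [h, LinearMap.trace_eq_matrix_trace ℝ b]
  have h1 : HasDerivAt (fun t : ℝ => 1 + M.trace * t) M.trace 0 := by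
    simpa using ((hasDerivAt_id (0 : ℝ)).const_mul M.trace).const_add 1
  have h2 := (Polynomial.hasDerivAt
    (Matrix.det (1 + (Polynomial.X : Polynomial ℝ) • M.map Polynomial.C)).divX.divX (0 : ℝ)).mul
      (hasDerivAt_pow 2 (0 : ℝ))
  refine (h1.add h2).congr_deriv ?_
  simp [M]

set_option maxSynthPendingDepth 3 in
/-- The second-order expansion `log det (1 + B) = tr B + O(‖B‖²)`. -/
theorem exists_abs_log_det_one_add_sub_trace_le :
    ∃ K δ : ℝ, 0 ≤ K ∧ 0 < δ ∧ ∀ B : V →L[ℝ] V, ‖B‖ < δ → 0 < (1 + B).det ∧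
      |Real.log (1 + B).det - LinearMap.trace ℝ V B| ≤ K * ‖B‖ ^ 2 := by
  have hdet : ContDiff ℝ 2 fun B : V →L[ℝ] V => (1 + B).det :=
    contDiff_det.comp (contDiff_const.add contDiff_id)
  have hdet1 : ((1 : V →L[ℝ] V) + 0).det = 1 := by
    rw [add_zero]; exact LinearMap.det_id
  set ψ : (V →L[ℝ] V) → ℝ := fun B => Real.log (1 + B).det with hψ
  have hψ0 : ψ 0 = 0 := by simp only [hψ, hdet1, Real.log_one]
  have hpos : ∀ᶠ B in 𝓝 (0 : V →L[ℝ] V), 0 < (1 + B).det :=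
    continuousAt_const.eventually_lt hdet.continuous.continuousAt (by rw [hdet1]; norm_num)
  have hc : ContDiffAt ℝ 2 ψ 0 := hdet.contDiffAt.log (by rw [hdet1]; norm_num)
  -- The derivative of a `C²` function is locally Lipschitz; the mean value inequality on the ball
  -- of radius `‖B‖` then gives a quadratic remainder.
  obtain ⟨K, t, ht, hlip⟩ := (hc.fderiv_right (m := 1) (by norm_num)).exists_lipschitzOnWith
  have hdiff : ∀ᶠ B in 𝓝 (0 : V →L[ℝ] V), DifferentiableAt ℝ ψ B :=
    hpos.mono fun B hB => (hdet.differentiable two_ne_zero B).log hB.ne'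
  obtain ⟨δ, hδ, hball⟩ := Metric.eventually_nhds_iff_ball.1 (hpos.and (hdiff.and ht))
  have hder : ∀ B, fderiv ℝ ψ 0 B = LinearMap.trace ℝ V B := by
    intro B
    have h1 : HasDerivAt (fun t : ℝ => t • B) B 0 := by
      simpa using (hasDerivAt_id (0 : ℝ)).smul_const B
    have h2 : HasDerivAt (fun t : ℝ => ψ (t • B)) (fderiv ℝ ψ 0 B) 0 := by
      refine HasFDerivAt.comp_hasDerivAt (l := ψ) (l' := fderiv ℝ ψ 0) (f := fun t : ℝ => t • B)
        0 ?_ h1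
      rw [zero_smul]
      exact (hc.differentiableAt two_ne_zero).hasFDerivAt
    have h3 := (hasDerivAt_det_one_add_smul B).log (by rw [zero_smul, hdet1]; norm_num)
    rw [zero_smul, hdet1, div_one] at h3
    exact h2.unique h3
  refine ⟨K, δ, K.2, hδ, fun B hB => ⟨(hball B (mem_ball_zero_iff.2 hB)).1, ?_⟩⟩
  have hmem : ∀ A ∈ Metric.closedBall (0 : V →L[ℝ] V) ‖B‖, A ∈ Metric.ball (0 : V →L[ℝ] V) δ :=
    fun A hA => mem_ball_zero_iff.2 ((mem_closedBall_zero_iff.1 hA).trans_lt hB)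
  have := (convex_closedBall (0 : V →L[ℝ] V) ‖B‖).norm_image_sub_le_of_norm_hasFDerivWithin_le'
    (f := ψ) (f' := fderiv ℝ ψ) (φ := fderiv ℝ ψ 0) (C := K * ‖B‖) (x := 0) (y := B)
    (fun A hA => (hball A (hmem A hA)).2.1.hasFDerivAt.hasFDerivWithinAt)
    (fun A hA => by
      have h := hlip.norm_sub_le (hball A (hmem A hA)).2.2 (mem_of_mem_nhds ht)
      refine h.trans ?_
      rw [sub_zero]
      exact mul_le_mul_of_nonneg_left (mem_closedBall_zero_iff.1 hA) K.2)
    (Metric.mem_closedBall_self (norm_nonneg _)) (mem_closedBall_zero_iff.2 le_rfl)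
  rw [hψ0, sub_zero, sub_zero, hder, Real.norm_eq_abs] at this
  rw [pow_two, ← mul_assoc]
  exact this

end LogDet

/-! ### Small perturbations of the identity -/

section Perturbation

variable {V : Type*} [NormedAddCommGroup V] [NormedSpace ℝ V] [CompleteSpace V]

/-- A perturbation of the identity by a contraction is a homeomorphism. -/
theorem exists_homeomorph_id_add {G : V → V} {c : NNReal} (hG : LipschitzWith c G) (hc : c < 1) :
    ∃ e : V ≃ₜ V, ∀ x, e x = x + G x := by
  have h : ApproximatesLinearOn (fun x => x + G x)
      ((ContinuousLinearEquiv.refl ℝ V : V ≃L[ℝ] V) : V →L[ℝ] V) Set.univ c := by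
    intro x _ y _
    change ‖x + G x - (y + G y) - (x - y)‖ ≤ c * ‖x - y‖
    rw [show x + G x - (y + G y) - (x - y) = G x - G y by abel]
    exact hG.norm_sub_le x y
  refine ⟨h.toHomeomorph _ ?_, fun x => rfl⟩
  rcases subsingleton_or_nontrivial V with hV | hV
  · exact Or.inl hV
  · right
    have : ‖((ContinuousLinearEquiv.refl ℝ V).symm : V →L[ℝ] V)‖₊ = 1 :=
      NNReal.eq ContinuousLinearMap.norm_id
    rw [this, inv_one]
    exact hc

end Perturbation

/-! ### Moving the transport from the source to the target -/

section ChangeOfVariables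

/-- Data processing along `e` and along its inverse gives the two inequalities. -/
theorem klDiv_map_equiv {α β : Type*} [MeasurableSpace α] [MeasurableSpace β] (e : α ≃ᵐ β)
    (μ : Measure α) (ν : Measure β) [IsProbabilityMeasure μ] [IsProbabilityMeasure ν] :
    klDiv (μ.map e) ν = klDiv μ (ν.map e.symm) := by
  have : IsProbabilityMeasure (μ.map e) :=
    Measure.isProbabilityMeasure_map e.measurable.aemeasurable
  have : IsProbabilityMeasure (ν.map e.symm) :=
    Measure.isProbabilityMeasure_map e.symm.measurable.aemeasurable
  have h1 : (μ.map e).map e.symm = μ := e.map_symm_map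
  have h2 : (ν.map e.symm).map e = ν := e.map_map_symm
  apply le_antisymm
  · calc klDiv (μ.map e) ν = klDiv (μ.map e) ((ν.map e.symm).map e) := by rw [h2]
      _ ≤ _ := klDiv_map_le _ _ e.measurable
  · calc klDiv μ (ν.map e.symm) = klDiv ((μ.map e).map e.symm) (ν.map e.symm) := by rw [h1]
      _ ≤ _ := klDiv_map_le _ _ e.symm.measurable

/-- The log-likelihood ratio changes by `-g`. As `P'` is a probability measure, `∫ exp g dP = 1`, so
`P'` is the exponential tilt of `P` with normalising constant `1`. -/
theorem klDiv_withDensity_exp {α : Type*} [MeasurableSpace α] {q P P' : Measure α}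
    [IsProbabilityMeasure q] [IsProbabilityMeasure P] [IsProbabilityMeasure P'] {g : α → ℝ}
    (hg : Measurable g) (hP' : P' = P.withDensity fun x => ENNReal.ofReal (Real.exp (g x)))
    (hfin : klDiv q P ≠ ∞) (hgi : Integrable g q) :
    klDiv q P' ≠ ∞ ∧ (klDiv q P').toReal = (klDiv q P).toReal - ∫ x, g x ∂q := by
  obtain ⟨hac, hint⟩ := klDiv_ne_top_iff.1 hfin
  have hexp : Measurable fun x => Real.exp (g x) := Real.measurable_exp.comp hg
  have hone : ∫⁻ x, ENNReal.ofReal (Real.exp (g x)) ∂P = 1 := by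
    rw [← setLIntegral_univ, ← withDensity_apply _ MeasurableSet.univ, ← hP', measure_univ]
  have hei : Integrable (fun x => Real.exp (g x)) P := by
    refine ⟨hexp.aestronglyMeasurable, ?_⟩
    rw [hasFiniteIntegral_iff_ofReal (ae_of_all _ fun x => (Real.exp_pos _).le), hone]
    exact ENNReal.one_lt_top
  have hone' : ∫ x, Real.exp (g x) ∂P = 1 := by
    rw [integral_eq_lintegral_of_nonneg_ae (ae_of_all _ fun x => (Real.exp_pos _).le)
      hexp.aestronglyMeasurable, hone, ENNReal.toReal_one]
  have htilt : P' = P.tilted g := by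
    rw [hP', Measure.tilted, hone']
    simp only [div_one]
  have hac' : q ≪ P' := by
    rw [htilt]
    exact hac.trans (absolutelyContinuous_tilted hei)
  have hint' : Integrable (llr q P') q := by
    rw [htilt]
    exact integrable_llr_tilted_right hac hgi hint hei
  refine ⟨klDiv_ne_top hac' hint', ?_⟩
  rw [toReal_klDiv_of_measure_eq hac' (by simp), toReal_klDiv_of_measure_eq hac (by simp), htilt,
    integral_llr_tilted_right hac hgi hei hint, hone', Real.log_one, add_zero]

variable {V : Type*} [NormedAddCommGroup V] [NormedSpace ℝ V] [FiniteDimensional ℝ V]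
  [MeasurableSpace V] [BorelSpace V]

theorem measurable_det_fderiv (T : V → V) : Measurable fun x => (fderiv ℝ T x).det :=
  (contDiff_det (n := 0)).continuous.measurable.comp (measurable_fderiv ℝ T)

/-- The pulled-back density is `p(e x) det De(x)`; dividing by `p(x) > 0` expresses it relative to
the original target. -/
theorem map_symm_eq_withDensity_exp (μ : Measure V) [μ.IsAddHaarMeasure] {p : V → ℝ}
    (hp : Continuous p) (hp0 : ∀ x, 0 < p x) (e : V ≃ᵐ V) (he : Differentiable ℝ e)
    (hdet : ∀ x, 0 < (fderiv ℝ e x).det) :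
    (μ.withDensity fun x => ENNReal.ofReal (p x)).map e.symm =
      (μ.withDensity fun x => ENNReal.ofReal (p x)).withDensity fun x => ENNReal.ofReal
        (Real.exp (Real.log (p (e x)) - Real.log (p x) + Real.log (fderiv ℝ e x).det)) := by
  have hpm : Measurable fun x => ENNReal.ofReal (p x) := hp.measurable.ennreal_ofReal
  have hgm : Measurable fun x => ENNReal.ofReal
      (Real.exp (Real.log (p (e x)) - Real.log (p x) + Real.log (fderiv ℝ e x).det)) :=
    (Real.measurable_exp.comp (((Real.measurable_log.comp (hp.measurable.comp e.measurable)).sub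
      (Real.measurable_log.comp hp.measurable)).add
        (Real.measurable_log.comp (measurable_det_fderiv e)))).ennreal_ofReal
  ext s hs
  have himage : e.symm ⁻¹' s = e '' s := (e.image_eq_preimage_symm s).symm
  have hms : MeasurableSet (e '' s) := (e.measurableSet_image).2 hs
  rw [Measure.map_apply e.symm.measurable hs, himage, withDensity_apply _ hms,
    lintegral_image_eq_lintegral_abs_det_fderiv_mul μ hs
      (fun x _ => (he x).hasFDerivAt.hasFDerivWithinAt) e.injective.injOn,
    withDensity_apply _ hs, setLIntegral_withDensity_eq_setLIntegral_mul _ hpm hgm hs]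
  refine setLIntegral_congr_fun hs fun x _ => ?_
  simp only [Pi.mul_apply]
  rw [← ENNReal.ofReal_mul (abs_nonneg _), ← ENNReal.ofReal_mul (hp0 x).le, Real.exp_add,
    Real.exp_sub, Real.exp_log (hp0 _), Real.exp_log (hp0 _), Real.exp_log (hdet x),
    abs_of_pos (hdet x)]
  congr 1
  have := (hp0 x).ne'
  field_simp

end ChangeOfVariables

/-! ### First-order expansion of the divergence -/

section Expansion

variable {n d : ℕ}

theorem RegularDensity.differentiable_log {q P : Measure (Mat n d)} {p : Mat n d → ℝ}
    (hp : RegularDensity q P p) : Differentiable ℝ fun M => Real.log (p M) :=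
  fun M => (hp.differentiable M).log (hp.pos M).ne'

/-- Taylor's formula with a Lipschitz derivative on a ball around the base point. -/
theorem abs_sub_sub_fderiv_le {V : Type*} [NormedAddCommGroup V] [NormedSpace ℝ V] {φ : V → ℝ}
    (hφ : Differentiable ℝ φ) {x : V} {δ l : ℝ} (hl : 0 ≤ l)
    (h : ∀ v, ‖v‖ ≤ δ → ‖fderiv ℝ φ (x + v) - fderiv ℝ φ x‖ ≤ l * ‖v‖) {v : V} (hv : ‖v‖ ≤ δ) :
    |φ (x + v) - φ x - fderiv ℝ φ x v| ≤ l * ‖v‖ ^ 2 := by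
  have := (convex_closedBall x ‖v‖).norm_image_sub_le_of_norm_hasFDerivWithin_le'
    (f := φ) (f' := fderiv ℝ φ) (φ := fderiv ℝ φ x) (C := l * ‖v‖) (x := x) (y := x + v)
    (fun y _ => (hφ y).hasFDerivAt.hasFDerivWithinAt)
    (fun y hy => by
      rw [mem_closedBall_iff_norm] at hy
      have := h (y - x) (hy.trans hv)
      rw [add_sub_cancel] at this
      exact this.trans (mul_le_mul_of_nonneg_left hy hl))
    (Metric.mem_closedBall_self (norm_nonneg _)) (by simp)
  rw [add_sub_cancel_left, Real.norm_eq_abs] at this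
  rw [pow_two, ← mul_assoc]
  exact this

/-- The integrand of the first variation of the divergence along the field `F`. -/
def firstVariation (p : Mat n d → ℝ) (F : Mat n d → Mat n d) (M : Mat n d) : ℝ :=
  fderiv ℝ (fun M => Real.log (p M)) M (F M) + LinearMap.trace ℝ (Mat n d) (fderiv ℝ F M)

theorem integrable_firstVariation {q P : Measure (Mat n d)} [IsProbabilityMeasure q]
    {p : Mat n d → ℝ} (hp : RegularDensity q P p) {F : Mat n d → Mat n d} (hF : Differentiable ℝ F)
    {A C : ℝ} (hA : ∀ M, ‖F M‖ ≤ A) (hC : ∀ M, ‖fderiv ℝ F M‖ ≤ C) :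
    Integrable (firstVariation p F) q := by
  refine Integrable.add ?_ ?_
  · refine Integrable.mono' (hp.integrable.norm.mul_const A) ?_ (ae_of_all _ fun M => ?_)
    · exact isBoundedBilinearMap_apply.continuous.comp_aestronglyMeasurable₂
        hp.integrable.aestronglyMeasurable hF.continuous.aestronglyMeasurable
    · exact (ContinuousLinearMap.le_opNorm _ _).trans
        (mul_le_mul_of_nonneg_left (hA M) (norm_nonneg _))
  · let τ : (Mat n d →L[ℝ] Mat n d) →L[ℝ] ℝ :=
      (LinearMap.trace ℝ (Mat n d) ∘ₗ ContinuousLinearMap.coeLM ℝ).toContinuousLinearMap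
    have hτ : (fun M => LinearMap.trace ℝ (Mat n d) (fderiv ℝ F M)) = fun M => τ (fderiv ℝ F M) :=
      rfl
    rw [hτ]
    refine Integrable.of_bound (C := ‖τ‖ * C)
      (τ.continuous.measurable.comp (measurable_fderiv ℝ F)).aestronglyMeasurable
      (ae_of_all _ fun M => ?_)
    exact (τ.le_opNorm _).trans (mul_le_mul_of_nonneg_left (hC M) (norm_nonneg _))

/-- Expansion of the divergence to a fixed target under a small displacement `M ↦ M + ε F(M)`. -/
theorem klDiv_map_add_smul_expansion {q P : Measure (Mat n d)} [IsProbabilityMeasure q]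
    [IsProbabilityMeasure P] {p : Mat n d → ℝ} (hp : RegularDensity q P p)
    (hfin : klDiv q P ≠ ∞) {F : Mat n d → Mat n d} (hF : Differentiable ℝ F)
    {A C : ℝ} (hA : ∀ M, ‖F M‖ ≤ A) (hC : ∀ M, ‖fderiv ℝ F M‖ ≤ C) :
    ∃ K : ℝ, ∀ᶠ ε in 𝓝 (0 : ℝ), klDiv (q.map fun M => M + ε • F M) P ≠ ∞ ∧
      |(klDiv (q.map fun M => M + ε • F M) P).toReal - (klDiv q P).toReal
        + ε * ∫ M, firstVariation p F M ∂q| ≤ K * ε ^ 2 := by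
  obtain ⟨δ, hδ, L, hL, hLip⟩ := hp.lipschitz
  obtain ⟨K₀, η, hK₀, hη, hlog⟩ := exists_abs_log_det_one_add_sub_trace_le (V := Mat n d)
  have hA0 : 0 ≤ A := (norm_nonneg _).trans (hA 0)
  have hC0 : 0 ≤ C := (norm_nonneg _).trans (hC 0)
  set b : Mat n d → ℝ := fun M => |L M| * A ^ 2 + K₀ * C ^ 2 with hb
  have hbi : Integrable b q := (hL.abs.mul_const _).add (integrable_const _)
  -- `b` collects the two pointwise remainders, from Taylor's formula for `log p` and from the
  -- log-determinant. The absolute value is there because `L` has no prescribed sign.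
  refine ⟨∫ M, b M ∂q, ?_⟩
  have hev : ∀ (c r : ℝ), 0 < r → ∀ᶠ ε in 𝓝 (0 : ℝ), |ε| * c < r := fun c r hr => by
    have hc : Continuous fun ε : ℝ => |ε| * c := continuous_abs.mul continuous_const
    exact hc.continuousAt.eventually_lt continuousAt_const (by simpa using hr)
  -- In turn: displacements stay in the Lipschitz window of `log p`, Jacobians stay in the range of
  -- the log-determinant bound, and `εF` is a contraction.
  filter_upwards [hev A δ hδ, hev C η hη, hev C 1 one_pos] with ε hε1 hε2 hε3
  have hGd : Differentiable ℝ fun M => ε • F M := hF.const_smul ε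
  have hGf : ∀ M, fderiv ℝ (fun M => ε • F M) M = ε • fderiv ℝ F M := fun M =>
    fderiv_const_smul (hF M) ε
  have hGn : ∀ M, ‖ε • fderiv ℝ F M‖ ≤ |ε| * C := fun M => by
    rw [norm_smul, Real.norm_eq_abs]
    exact mul_le_mul_of_nonneg_left (hC M) (abs_nonneg _)
  have hlip : LipschitzWith (Real.toNNReal (|ε| * C)) fun M => ε • F M :=
    lipschitzWith_of_nnnorm_fderiv_le hGd fun M => by
      rw [hGf, ← NNReal.coe_le_coe, Real.coe_toNNReal _ (by positivity)]
      exact hGn M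
  obtain ⟨e₀, he₀⟩ := exists_homeomorph_id_add hlip
    (by rw [← NNReal.coe_lt_coe, Real.coe_toNNReal _ (by positivity)]; simpa using hε3)
  let e : Mat n d ≃ᵐ Mat n d := e₀.toMeasurableEquiv
  have he : (e : Mat n d → Mat n d) = fun M => M + ε • F M := funext he₀
  have hed : Differentiable ℝ e := by rw [he]; exact differentiable_id.add hGd
  have hef : ∀ M, fderiv ℝ e M = 1 + ε • fderiv ℝ F M := fun M => by
    rw [he, ← hGf]
    exact (((hasFDerivAt_id M).add (hGd M).hasFDerivAt)).fderiv
  have hB : ∀ M, 0 < (1 + ε • fderiv ℝ F M).det ∧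
      |Real.log (1 + ε • fderiv ℝ F M).det - LinearMap.trace ℝ (Mat n d)
        ((ε • fderiv ℝ F M : Mat n d →L[ℝ] Mat n d) : Mat n d →ₗ[ℝ] Mat n d)|
        ≤ K₀ * ‖ε • fderiv ℝ F M‖ ^ 2 := fun M => hlog _ ((hGn M).trans_lt hε2)
  set g : Mat n d → ℝ := fun M =>
    Real.log (p (e M)) - Real.log (p M) + Real.log (fderiv ℝ e M).det with hg
  have hpc : Continuous p := hp.differentiable.continuous
  have hgm : Measurable g :=
    ((Real.measurable_log.comp (hpc.measurable.comp e.measurable)).sub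
      (Real.measurable_log.comp hpc.measurable)).add
        (Real.measurable_log.comp (measurable_det_fderiv e))
  have hP' : P.map e.symm = P.withDensity fun M => ENNReal.ofReal (Real.exp (g M)) := by
    rw [hp.density]
    exact map_symm_eq_withDensity_exp volume hpc hp.pos e hed fun M => by
      rw [hef]; exact (hB M).1
  have hgb : ∀ᵐ M ∂q, |g M - ε * firstVariation p F M| ≤ ε ^ 2 * b M := by
    filter_upwards [hLip] with M hM
    have hv : ‖ε • F M‖ ≤ |ε| * A := by
      rw [norm_smul, Real.norm_eq_abs]
      exact mul_le_mul_of_nonneg_left (hA M) (abs_nonneg _)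
    have h1 := abs_sub_sub_fderiv_le hp.differentiable_log (x := M) (δ := δ) (abs_nonneg (L M))
      (fun v hv => (hM v hv).trans
        (mul_le_mul_of_nonneg_right (le_abs_self _) (norm_nonneg _))) (hv.trans hε1.le)
    have h2 := (hB M).2
    have e1 : g M - ε * firstVariation p F M
        = (Real.log (p (M + ε • F M)) - Real.log (p M)
            - fderiv ℝ (fun M => Real.log (p M)) M (ε • F M))
          + (Real.log (1 + ε • fderiv ℝ F M).det - LinearMap.trace ℝ (Mat n d)
        ((ε • fderiv ℝ F M : Mat n d →L[ℝ] Mat n d) : Mat n d →ₗ[ℝ] Mat n d)) := by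
      simp only [hg, hef]
      simp only [he, firstVariation, map_smul, smul_eq_mul,
        ContinuousLinearMap.toLinearMap_smul]
      ring
    rw [e1]
    calc _ ≤ _ := abs_add_le _ _
      _ ≤ |L M| * (|ε| * A) ^ 2 + K₀ * (|ε| * C) ^ 2 := by
        refine add_le_add (h1.trans ?_) (h2.trans ?_)
        · gcongr
        · gcongr
          exact hGn M
      _ = ε ^ 2 * b M := by
        rw [mul_pow, mul_pow, sq_abs]
        simp only [hb]
        ring
  have hDi := integrable_firstVariation hp hF hA hC
  have hri : Integrable (fun M => g M - ε * firstVariation p F M) q :=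
    Integrable.mono' (hbi.const_mul _)
      (hgm.aestronglyMeasurable.sub (hDi.const_mul ε).aestronglyMeasurable) hgb
  have hgi : Integrable g q := by
    refine (hri.add (hDi.const_mul ε)).congr (ae_of_all _ fun M => ?_)
    simp
  have : IsProbabilityMeasure (P.map e.symm) :=
    Measure.isProbabilityMeasure_map e.symm.measurable.aemeasurable
  obtain ⟨hne, heq⟩ := klDiv_withDensity_exp hgm hP' hfin hgi
  rw [← he, klDiv_map_equiv]
  refine ⟨hne, ?_⟩
  rw [heq]
  have e2 : (klDiv q P).toReal - ∫ M, g M ∂q - (klDiv q P).toReal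
      + ε * ∫ M, firstVariation p F M ∂q = -∫ M, (g M - ε * firstVariation p F M) ∂q := by
    rw [integral_sub hgi (hDi.const_mul ε), integral_const_mul]
    ring
  have hfinal := norm_integral_le_of_norm_le
    (f := fun M => g M - ε * firstVariation p F M) (hbi.const_mul (ε ^ 2)) hgb
  rw [integral_const_mul] at hfinal
  rw [e2, abs_neg, mul_comm]
  exact hfinal

end Expansion

/-! ### Kernel sections and boundedness of elements of the RKHS -/

section Kernel

variable {d : ℕ} {H : Type*} [NormedAddCommGroup H] [InnerProductSpace ℝ H] [CompleteSpace H]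
  [RKHS ℝ H (Pt d) (Pt d)] {κ : Pt d → Pt d → ℝ}

theorem inner_kerFun_kerFun
    (hH : ∀ x y, RKHS.kernel H x y = κ x y • ContinuousLinearMap.id ℝ (Pt d)) (x y v w : Pt d) :
    inner ℝ (RKHS.kerFun H y v) (RKHS.kerFun H x w) = κ x y * inner ℝ v w := by
  rw [← RKHS.kernel_inner, hH, smul_apply, real_inner_smul_left]
  rfl

/-- The Gram kernel of `x ↦ K_x w` is `κ`, with its arguments swapped, times `‖w‖²`, which is `C²`.
-/
theorem differentiable_kerFun (hκ : RegularKernel κ)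
    (hH : ∀ x y, RKHS.kernel H x y = κ x y • ContinuousLinearMap.id ℝ (Pt d)) (w : Pt d) :
    Differentiable ℝ fun x => RKHS.kerFun H x w := by
  refine differentiable_of_contDiff_inner ?_
  simp only [inner_kerFun_kerFun hH]
  exact (hκ.contDiff.comp (contDiff_snd.prodMk contDiff_fst)).mul contDiff_const

theorem differentiable_kernel_right (hκ : RegularKernel κ) (y : Pt d) : Differentiable ℝ (κ y) :=
  (hκ.contDiff.comp (contDiff_const.prodMk contDiff_id)).differentiable two_ne_zero

theorem inner_fderiv_kerFun_left (hκ : RegularKernel κ)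
    (hH : ∀ x y, RKHS.kernel H x y = κ x y • ContinuousLinearMap.id ℝ (Pt d)) (w x v : Pt d)
    (f : H) : inner ℝ (fderiv ℝ (fun x => RKHS.kerFun H x w) x v) f
      = fderiv ℝ (fun x => inner ℝ (RKHS.kerFun H x w) f) x v := by
  rw [fderiv_inner_apply ℝ (differentiable_kerFun hκ hH w x) (differentiableAt_const f)]
  simp

theorem inner_fderiv_kerFun_kerFun (hκ : RegularKernel κ)
    (hH : ∀ x y, RKHS.kernel H x y = κ x y • ContinuousLinearMap.id ℝ (Pt d)) (x y v w w' : Pt d) :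
    inner ℝ (fderiv ℝ (fun x => RKHS.kerFun H x w) x v) (RKHS.kerFun H y w')
      = fderiv ℝ (κ y) x v * inner ℝ w w' := by
  rw [inner_fderiv_kerFun_left hκ hH]
  simp only [inner_kerFun_kerFun hH]
  rw [fderiv_mul_const (differentiable_kernel_right hκ y x), smul_apply, smul_eq_mul, mul_comm]

/-- With `D` the derivative on the left, `⟨K_y w, D⟩ = ∂_v κ(y, ·)(x) ‖w‖²`. Differentiating in `y`
along `v` at `x` turns `K_y w` into `D` as well. -/
theorem norm_fderiv_kerFun_sq (hκ : RegularKernel κ)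
    (hH : ∀ x y, RKHS.kernel H x y = κ x y • ContinuousLinearMap.id ℝ (Pt d)) (x v w : Pt d) :
    ‖fderiv ℝ (fun x => RKHS.kerFun H x w) x v‖ ^ 2
      = fderiv ℝ (fun y => fderiv ℝ (κ y) x v) x v * ‖w‖ ^ 2 := by
  rcases eq_or_ne w 0 with rfl | hw
  · simp
  set D := fderiv ℝ (fun x => RKHS.kerFun H x w) x v with hD
  have hw2 : ‖w‖ ^ 2 ≠ 0 := by simpa using hw
  have h : (fun y => fderiv ℝ (κ y) x v)
      = fun y => inner ℝ (RKHS.kerFun H y w) D * (‖w‖ ^ 2)⁻¹ := by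
    ext y
    rw [real_inner_comm, hD, inner_fderiv_kerFun_kerFun hκ hH, real_inner_self_eq_norm_sq,
      mul_inv_cancel_right₀ hw2]
  rw [h, fderiv_mul_const ((differentiable_kerFun hκ hH w x).inner ℝ (differentiableAt_const D)),
    smul_apply, ← inner_fderiv_kerFun_left hκ hH, ← hD, real_inner_self_eq_norm_sq, smul_eq_mul]
  field_simp

theorem exists_norm_kerFun_le (hκ : RegularKernel κ)
    (hH : ∀ x y, RKHS.kernel H x y = κ x y • ContinuousLinearMap.id ℝ (Pt d)) :
    ∃ B, 0 ≤ B ∧ ∀ x w : Pt d, ‖RKHS.kerFun H x w‖ ≤ B * ‖w‖ := by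
  obtain ⟨B, hB⟩ := hκ.bounded
  refine ⟨√|B|, Real.sqrt_nonneg _, fun x w => le_of_sq_le_sq ?_ (by positivity)⟩
  rw [← real_inner_self_eq_norm_sq, inner_kerFun_kerFun hH, real_inner_self_eq_norm_sq, mul_pow,
    Real.sq_sqrt (abs_nonneg _)]
  gcongr
  exact (hB x).trans (le_abs_self _)

theorem exists_norm_fderiv_kerFun_le (hκ : RegularKernel κ)
    (hH : ∀ x y, RKHS.kernel H x y = κ x y • ContinuousLinearMap.id ℝ (Pt d)) :
    ∃ C, 0 ≤ C ∧ ∀ x v w : Pt d,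
      ‖fderiv ℝ (fun x => RKHS.kerFun H x w) x v‖ ≤ C * ‖v‖ * ‖w‖ := by
  obtain ⟨C, hC⟩ := hκ.mixed_bounded
  refine ⟨√|C|, Real.sqrt_nonneg _, fun x v w => le_of_sq_le_sq ?_ (by positivity)⟩
  rw [norm_fderiv_kerFun_sq hκ hH, mul_pow, mul_pow, Real.sq_sqrt (abs_nonneg _)]
  gcongr
  refine (hC x v).trans ?_
  gcongr
  exact le_abs_self _

theorem differentiable_coe (hκ : RegularKernel κ)
    (hH : ∀ x y, RKHS.kernel H x y = κ x y • ContinuousLinearMap.id ℝ (Pt d)) (f : H) :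
    Differentiable ℝ f := by
  refine differentiable_euclidean.2 fun k => ?_
  have h : (fun x => f x k)
      = fun x => inner ℝ (RKHS.kerFun H x (EuclideanSpace.single k (1 : ℝ))) f := by
    ext x
    rw [RKHS.kerFun_inner, EuclideanSpace.inner_single_left]
    simp
  rw [h]
  exact (differentiable_kerFun hκ hH _).inner ℝ (differentiable_const f)

theorem inner_fderiv_coe (hκ : RegularKernel κ)
    (hH : ∀ x y, RKHS.kernel H x y = κ x y • ContinuousLinearMap.id ℝ (Pt d)) (f : H)
    (x v w : Pt d) : inner ℝ w (fderiv ℝ f x v)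
      = inner ℝ (fderiv ℝ (fun x => RKHS.kerFun H x w) x v) f := by
  rw [inner_fderiv_kerFun_left hκ hH]
  simp only [RKHS.kerFun_inner]
  rw [fderiv_inner_apply ℝ (differentiableAt_const w) (differentiable_coe hκ hH f x)]
  simp

/-- Test the value against itself: `‖f x‖² = ⟨K_x (f x), f⟩ ≤ B ‖f x‖ ‖f‖`, then cancel one factor.
The bound on `Df` is obtained in the same way. -/
theorem exists_norm_coe_le (hκ : RegularKernel κ)
    (hH : ∀ x y, RKHS.kernel H x y = κ x y • ContinuousLinearMap.id ℝ (Pt d)) (f : H) :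
    ∃ A, 0 ≤ A ∧ ∀ x, ‖f x‖ ≤ A := by
  obtain ⟨B, hB0, hB⟩ := exists_norm_kerFun_le (H := H) hκ hH
  refine ⟨B * ‖f‖, by positivity, fun x => ?_⟩
  have h : ‖f x‖ * ‖f x‖ ≤ B * ‖f‖ * ‖f x‖ := by
    calc ‖f x‖ * ‖f x‖ = inner ℝ (RKHS.kerFun H x (f x)) f := by
          rw [RKHS.kerFun_inner, real_inner_self_eq_norm_mul_norm]
      _ ≤ ‖RKHS.kerFun H x (f x)‖ * ‖f‖ := real_inner_le_norm _ _
      _ ≤ B * ‖f x‖ * ‖f‖ := by gcongr; exact hB x _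
      _ = _ := by ring
  rcases (norm_nonneg (f x)).eq_or_lt with h0 | h0
  · rw [← h0]; positivity
  · exact le_of_mul_le_mul_right h h0

theorem exists_norm_fderiv_coe_le (hκ : RegularKernel κ)
    (hH : ∀ x y, RKHS.kernel H x y = κ x y • ContinuousLinearMap.id ℝ (Pt d)) (f : H) :
    ∃ C, 0 ≤ C ∧ ∀ x, ‖fderiv ℝ f x‖ ≤ C := by
  obtain ⟨C, hC0, hC⟩ := exists_norm_fderiv_kerFun_le (H := H) hκ hH
  refine ⟨C * ‖f‖, by positivity, fun x => ContinuousLinearMap.opNorm_le_bound _ (by positivity)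
    fun v => ?_⟩
  set y := fderiv ℝ f x v with hy
  have h : ‖y‖ * ‖y‖ ≤ C * ‖f‖ * ‖v‖ * ‖y‖ := by
    calc ‖y‖ * ‖y‖ = inner ℝ (fderiv ℝ (fun x => RKHS.kerFun H x y) x v) f := by
          rw [← inner_fderiv_coe hκ hH, ← hy, real_inner_self_eq_norm_mul_norm]
      _ ≤ ‖fderiv ℝ (fun x => RKHS.kerFun H x y) x v‖ * ‖f‖ := real_inner_le_norm _ _
      _ ≤ C * ‖v‖ * ‖y‖ * ‖f‖ := by gcongr; exact hC x v y
      _ = _ := by ring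
  rcases (norm_nonneg y).eq_or_lt with h0 | h0
  · rw [← h0]; positivity
  · exact le_of_mul_le_mul_right h h0

end Kernel

/-! ### Row-wise scores and block-diagonal traces -/

section Score

variable {n d : ℕ} {p : Mat n d → ℝ}

theorem inner_score (hp : Differentiable ℝ fun M => Real.log (p M)) (M : Mat n d) (i : Fin n)
    (v : Pt d) : inner ℝ (score p M i) v
      = fderiv ℝ (fun M => Real.log (p M)) M (Pi.single i v) := by
  have h1 : HasFDerivAt (fun x => Real.log (p (Function.update M i x)))
      ((fderiv ℝ (fun M => Real.log (p M)) M).comp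
        (ContinuousLinearMap.pi (Pi.single i (ContinuousLinearMap.id ℝ (Pt d))))) (M i) := by
    have h2 := hasFDerivAt_update (𝕜 := ℝ) M (i := i) (M i)
    have h3 := (hp (Function.update M i (M i))).hasFDerivAt
    have h4 := h3.comp (M i) h2
    rwa [Function.update_eq_self] at h4
  rw [score, gradient, InnerProductSpace.toDual_symm_apply, h1.fderiv]
  rw [ContinuousLinearMap.comp_apply]
  congr 1
  ext j
  rcases eq_or_ne j i with rfl | hj
  · simp
  · simp [hj]

theorem sum_inner_score (hp : Differentiable ℝ fun M => Real.log (p M)) (M Δ : Mat n d) :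
    ∑ i, inner ℝ (score p M i) (Δ i) = fderiv ℝ (fun M => Real.log (p M)) M Δ := by
  simp only [inner_score hp, ← map_sum]
  congr 1
  exact Finset.univ_sum_single Δ

/-- Split the block-diagonal map into inclusion–block–projection terms and use cyclicity of the
trace. -/
theorem trace_pi_comp_proj (g : Fin n → Pt d →L[ℝ] Pt d) :
    LinearMap.trace ℝ (Mat n d)
      (ContinuousLinearMap.pi fun i => (g i).comp (ContinuousLinearMap.proj i) :
        Mat n d →L[ℝ] Mat n d) = ∑ i, LinearMap.trace ℝ (Pt d) (g i) := by
  have h : ((ContinuousLinearMap.pi fun i => (g i).comp (ContinuousLinearMap.proj i) :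
      Mat n d →L[ℝ] Mat n d) : Mat n d →ₗ[ℝ] Mat n d)
      = ∑ i, LinearMap.single ℝ (fun _ => Pt d) i ∘ₗ ((g i : Pt d →ₗ[ℝ] Pt d) ∘ₗ
        LinearMap.proj i) := by
    refine LinearMap.ext fun M => ?_
    rw [LinearMap.sum_apply]
    exact (Finset.univ_sum_single fun i => g i (M i)).symm
  rw [h, map_sum]
  refine Finset.sum_congr rfl fun i _ => ?_
  rw [LinearMap.trace_comp_comm', LinearMap.comp_assoc, LinearMap.proj_comp_single_same,
    LinearMap.comp_id]

end Score

/-! ### The Stein element of the RKHS -/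

section SteinElement

variable {d : ℕ} {H : Type*} [NormedAddCommGroup H] [InnerProductSpace ℝ H] [CompleteSpace H]
  [RKHS ℝ H (Pt d) (Pt d)] {κ : Pt d → Pt d → ℝ}

/-- The coordinate vectors of `ℝᵈ`. -/
abbrev coordVec {d : ℕ} (k : Fin d) : Pt d := EuclideanSpace.basisFun (Fin d) ℝ k

theorem sum_inner_coordVec_smul (v : Pt d) : ∑ k, inner ℝ (coordVec k) v • coordVec k = v :=
  (EuclideanSpace.basisFun (Fin d) ℝ).sum_repr' v

variable (H) in
/-- The element `κ(·, M) ∇_M log p(M) + ∇_M κ(·, M)` of the reproducing kernel Hilbert space. -/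
def steinElement (n : ℕ) (p : Mat n d → ℝ) (M : Mat n d) : H :=
  ∑ i, RKHS.kerFun H (M i) (score p M i)
    + ∑ i, ∑ k, fderiv ℝ (fun x => RKHS.kerFun H x (coordVec k)) (M i) (coordVec k)

theorem sum_inner_coordVec_fderiv_coe (hκ : RegularKernel κ)
    (hH : ∀ x y, RKHS.kernel H x y = κ x y • ContinuousLinearMap.id ℝ (Pt d)) (f : H) (x : Pt d) :
    ∑ k, inner ℝ (fderiv ℝ (fun x => RKHS.kerFun H x (coordVec k)) x (coordVec k)) f
      = LinearMap.trace ℝ (Pt d) (fderiv ℝ f x) := by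
  rw [LinearMap.trace_eq_sum_inner _ (EuclideanSpace.basisFun (Fin d) ℝ)]
  exact Finset.sum_congr rfl fun k _ => (inner_fderiv_coe hκ hH f x _ _).symm

/-- Pair both sides with `w`: the coordinate derivatives of `κ(ω, ·)`, weighted by the coordinates
of `w`, add up to its derivative along `w`. -/
theorem steinElement_apply (hκ : RegularKernel κ)
    (hH : ∀ x y, RKHS.kernel H x y = κ x y • ContinuousLinearMap.id ℝ (Pt d)) (n : ℕ)
    (p : Mat n d → ℝ) (M : Mat n d) (ω : Pt d) :
    steinElement H n p M ω = steinField κ p M ω := by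
  refine ext_inner_right ℝ fun w => ?_
  rw [← RKHS.inner_kerFun, steinElement, steinField]
  simp only [inner_add_left, sum_inner]
  congr 1
  · refine Finset.sum_congr rfl fun i _ => ?_
    rw [inner_kerFun_kerFun hH, real_inner_smul_left]
  · refine Finset.sum_congr rfl fun i _ => ?_
    simp only [inner_fderiv_kerFun_kerFun hκ hH]
    rw [gradient, InnerProductSpace.toDual_symm_apply]
    conv_rhs => rw [← sum_inner_coordVec_smul w]
    rw [map_sum]
    refine Finset.sum_congr rfl fun k _ => ?_
    rw [map_smul, smul_eq_mul, mul_comm]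

/-- The displacement field on matrices obtained by applying `f` to every row. -/
def rowwise {n : ℕ} (f : Pt d → Pt d) (M : Mat n d) : Mat n d := fun i => f (M i)

theorem hasFDerivAt_rowwise {n : ℕ} {f : Pt d → Pt d} (hf : Differentiable ℝ f) (M : Mat n d) :
    HasFDerivAt (rowwise f)
      (ContinuousLinearMap.pi fun i => (fderiv ℝ f (M i)).comp (ContinuousLinearMap.proj i)) M :=
  hasFDerivAt_pi.2 fun i => (hf (M i)).hasFDerivAt.comp M (hasFDerivAt_apply i M)

theorem norm_fderiv_rowwise_le {n : ℕ} {f : Pt d → Pt d} (hf : Differentiable ℝ f) {C : ℝ}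
    (hC0 : 0 ≤ C) (hC : ∀ x, ‖fderiv ℝ f x‖ ≤ C) (M : Mat n d) :
    ‖fderiv ℝ (rowwise f : Mat n d → Mat n d) M‖ ≤ C := by
  rw [(hasFDerivAt_rowwise hf M).fderiv]
  refine ContinuousLinearMap.opNorm_le_bound _ hC0 fun Δ => ?_
  refine (pi_norm_le_iff_of_nonneg (by positivity)).2 fun i => ?_
  calc ‖fderiv ℝ f (M i) (Δ i)‖ ≤ ‖fderiv ℝ f (M i)‖ * ‖Δ i‖ := ContinuousLinearMap.le_opNorm _ _
    _ ≤ C * ‖Δ‖ := by gcongr; exacts [hC _, norm_le_pi_norm Δ i]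

/-- The Stein element represents the first variation: the score part pairs to the derivative of `log
p` along `f`, and the kernel-gradient part to the divergence of `f` summed over rows. -/
theorem inner_steinElement (hκ : RegularKernel κ)
    (hH : ∀ x y, RKHS.kernel H x y = κ x y • ContinuousLinearMap.id ℝ (Pt d)) {n : ℕ}
    {p : Mat n d → ℝ} (hp : Differentiable ℝ fun M => Real.log (p M)) (M : Mat n d) (f : H) :
    inner ℝ (steinElement H n p M) f = firstVariation p (rowwise f) M := by
  rw [steinElement, firstVariation, ← sum_inner_score hp,
    (hasFDerivAt_rowwise (differentiable_coe hκ hH f) M).fderiv, trace_pi_comp_proj]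
  simp only [inner_add_left, sum_inner, RKHS.kerFun_inner]
  congr 1
  exact Finset.sum_congr rfl fun i _ => sum_inner_coordVec_fderiv_coe hκ hH f (M i)

theorem kerFun_eq_sum (x v : Pt d) :
    RKHS.kerFun H x v = ∑ k, inner ℝ (coordVec k) v • RKHS.kerFun H x (coordVec k) := by
  conv_lhs => rw [← sum_inner_coordVec_smul v]
  simp only [map_sum, map_smul]

/-- A pointwise limit of continuous difference quotients on `ℝᵈ`; separability of `H` is not
assumed. -/
theorem stronglyMeasurable_fderiv_kerFun (hκ : RegularKernel κ)
    (hH : ∀ x y, RKHS.kernel H x y = κ x y • ContinuousLinearMap.id ℝ (Pt d)) (w v : Pt d) :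
    StronglyMeasurable fun x => fderiv ℝ (fun x => RKHS.kerFun H x w) x v := by
  have hd := differentiable_kerFun (H := H) hκ hH w
  refine stronglyMeasurable_of_tendsto (𝓝[≠] (0 : ℝ))
    (f := fun t x => t⁻¹ • (RKHS.kerFun H (x + t • v) w - RKHS.kerFun H x w)) (fun t => ?_)
    (tendsto_pi_nhds.2 fun x => ?_)
  · refine Continuous.stronglyMeasurable (((Continuous.sub ?_ hd.continuous)).const_smul _)
    exact hd.continuous.comp (continuous_id.add continuous_const)
  · have h := (hd x).hasFDerivAt.hasLineDerivAt v
    have := hasDerivAt_iff_tendsto_slope_zero.1 h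
    simpa using this

theorem integrable_steinElement (hκ : RegularKernel κ)
    (hH : ∀ x y, RKHS.kernel H x y = κ x y • ContinuousLinearMap.id ℝ (Pt d)) {n : ℕ}
    {q P : Measure (Mat n d)} [IsProbabilityMeasure q] {p : Mat n d → ℝ}
    (hp : RegularDensity q P p) : Integrable (steinElement H n p) q := by
  obtain ⟨B, hB0, hB⟩ := exists_norm_kerFun_le (H := H) hκ hH
  obtain ⟨C, hC0, hC⟩ := exists_norm_fderiv_kerFun_le (H := H) hκ hH
  have hlog := hp.differentiable_log
  refine Integrable.add (integrable_finsetSum _ fun i _ => ?_)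
    (integrable_finsetSum _ fun i _ => integrable_finsetSum _ fun k _ => ?_)
  · have h : (fun M : Mat n d => RKHS.kerFun H (M i) (score p M i)) = fun M => ∑ k,
        fderiv ℝ (fun M => Real.log (p M)) M (Pi.single i (coordVec k))
          • RKHS.kerFun H (M i) (coordVec k) := by
      ext1 M
      rw [kerFun_eq_sum]
      refine Finset.sum_congr rfl fun k _ => ?_
      rw [real_inner_comm, inner_score hlog]
    rw [h]
    refine integrable_finsetSum _ fun k _ => ?_
    have hs : Integrable
        (fun M => fderiv ℝ (fun M => Real.log (p M)) M (Pi.single i (coordVec k))) q :=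
      hp.integrable.apply_continuousLinearMap _
    refine Integrable.mono' (hs.norm.mul_const (B * ‖(coordVec k : Pt d)‖))
      (hs.aestronglyMeasurable.smul ?_) (ae_of_all _ fun M => ?_)
    · exact (((differentiable_kerFun (H := H) hκ hH (coordVec k)).continuous).comp
        (continuous_apply i)).aestronglyMeasurable
    · rw [norm_smul]
      gcongr
      exact hB _ _
  · refine Integrable.of_bound (C := C * ‖(coordVec k : Pt d)‖ * ‖(coordVec k : Pt d)‖) ?_
      (ae_of_all _ fun M => hC _ _ _)
    exact ((stronglyMeasurable_fderiv_kerFun (H := H) hκ hH (coordVec k)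
      (coordVec k)).comp_measurable (measurable_pi_apply i)).aestronglyMeasurable

end SteinElement

/-! ### Functional gradients and steepest descent -/

section Gradient

variable {H : Type*} [NormedAddCommGroup H] [InnerProductSpace ℝ H]

theorem HasFunctionalGradient.hasLineDerivAt {F : H → ℝ≥0∞} {g G : H}
    (h : HasFunctionalGradient F g G) (v : H) :
    HasLineDerivAt ℝ (fun f => (F f).toReal) (inner ℝ G v) g v := by
  rw [HasLineDerivAt, hasDerivAt_iff_isLittleO_nhds_zero]
  simp only [zero_add, zero_smul, add_zero, smul_eq_mul]
  refine (h v).2.trans_isLittleO ?_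
  simpa using isLittleO_pow_pow (𝕜 := ℝ) one_lt_two

/-- The unique unit direction of steepest descent is opposite to a nonzero gradient. -/
theorem HasFunctionalGradient.isSteepestDescentDirection_iff {F : H → ℝ≥0∞} {g S : H}
    (h : HasFunctionalGradient F g (-S)) (hS : S ≠ 0) (u : H) :
    IsSteepestDescentDirection F g u ↔ u = ‖S‖⁻¹ • S := by
  have hS0 : ‖S‖ ≠ 0 := norm_ne_zero_iff.2 hS
  have hld : ∀ v, lineDeriv ℝ (fun f => (F f).toReal) g v = -inner ℝ S v := fun v => by
    rw [(h.hasLineDerivAt v).lineDeriv, inner_neg_left]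
  have hnorm : ‖‖S‖⁻¹ • S‖ = 1 := by
    rw [norm_smul, norm_inv, norm_norm, inv_mul_cancel₀ hS0]
  have hinner : inner ℝ S (‖S‖⁻¹ • S) = ‖S‖ := by
    rw [real_inner_smul_right, real_inner_self_eq_norm_sq]
    field_simp
  constructor
  · rintro ⟨hu, hmin⟩
    have h1 := (hmin _ hnorm).2
    rw [hld, hld, hinner] at h1
    have h2 := real_inner_le_norm S u
    rw [hu, mul_one] at h2
    -- Minimality gives `⟨S, u⟩ ≥ ‖S‖`, so Cauchy–Schwarz is an equality, which determines `u`.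
    have h3 : inner ℝ S u = ‖S‖ * ‖u‖ := by rw [hu, mul_one]; linarith
    rw [inner_eq_norm_mul_iff_real, hu, one_smul] at h3
    calc u = ‖S‖⁻¹ • (‖S‖ • u) := by rw [smul_smul, inv_mul_cancel₀ hS0, one_smul]
      _ = _ := by rw [← h3]
  · rintro rfl
    refine ⟨hnorm, fun v hv => ⟨(h.hasLineDerivAt v).lineDifferentiableAt, ?_⟩⟩
    rw [hld, hld, hinner]
    have h2 := real_inner_le_norm S v
    rw [hv, mul_one] at h2
    linarith

end Gradient

/-! ### Marginals of transported processes and empirical measures -/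

section Transport

variable {n d : ℕ}

theorem measurable_transport {g : Pt d → Pt d} (hg : Measurable g) :
    Measurable (transport g) :=
  measurable_pi_lambda _ fun ω => (measurable_pi_apply ω).add (hg.comp (measurable_pi_apply ω))

theorem marginal_map_transport {g : Pt d → Pt d} (hg : Measurable g) (Ω : Mat n d)
    (Q : Measure (Fun d)) :
    marginal Ω (Q.map (transport g)) = (marginal Ω Q).map fun M => M + rowwise g M := by
  have hm : Measurable fun M : Mat n d => M + rowwise g M :=
    measurable_id.add (measurable_pi_lambda _ fun i => hg.comp (measurable_pi_apply i))
  rw [marginal, marginal, Measure.map_map (measurable_evalAt Ω) (measurable_transport hg),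
    Measure.map_map hm (measurable_evalAt Ω)]
  rfl

theorem support_empiricalMeasure (Ω : Mat n d) : (empiricalMeasure Ω).support = Set.range Ω := by
  -- Without atoms the weight is infinite, but it multiplies the zero measure, so the support is
  -- empty.
  rcases Nat.eq_zero_or_pos n with rfl | hn
  · rw [empiricalMeasure, Finset.univ_eq_empty, Finset.sum_empty, smul_zero,
      Measure.support_zero, Set.range_eq_empty]
  have hle : ∀ s, (empiricalMeasure Ω) s = 0 ↔ ∀ i, Measure.dirac (Ω i) s = 0 := by
    intro s
    rw [empiricalMeasure, Measure.smul_apply, smul_eq_mul, mul_eq_zero,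
      Measure.finsetSum_apply, Finset.sum_eq_zero_iff]
    simp
  refine Set.Subset.antisymm ?_ ?_
  · refine Measure.support_subset_of_isClosed (Set.finite_range Ω).isClosed ?_
    rw [mem_ae_iff, hle]
    intro i
    rw [Measure.dirac_apply' _ (Set.finite_range Ω).measurableSet.compl]
    simp
  · rintro _ ⟨i, rfl⟩
    rw [Measure.mem_support_iff_forall]
    intro U hU
    rw [pos_iff_ne_zero, Ne, hle]
    intro h
    have := h i
    rw [Measure.dirac_apply_of_mem (mem_of_mem_nhds hU)] at this
    exact one_ne_zero this

/-- The divergence restricted to the support of an empirical measure is that of the marginals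
at its atoms. -/
theorem klDivOn_support_empiricalMeasure (Ω : Mat n d) (Q P : Measure (Fun d))
    [IsProbabilityMeasure Q] [IsProbabilityMeasure P] :
    klDivOn (empiricalMeasure Ω).support Q P = klDiv (marginal Ω Q) (marginal Ω P) := by
  rw [support_empiricalMeasure]
  set X := Set.range Ω
  have hX : Measurable (X.domRestrict : Fun d → X → Pt d) :=
    measurable_pi_lambda _ fun x => measurable_pi_apply _
  have hQ : IsProbabilityMeasure (Q.map X.domRestrict) :=
    Measure.isProbabilityMeasure_map hX.aemeasurable
  have hP : IsProbabilityMeasure (P.map X.domRestrict) :=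
    Measure.isProbabilityMeasure_map hX.aemeasurable
  let φ : (X → Pt d) → Mat n d := fun h i => h ⟨Ω i, i, rfl⟩
  have hφ : Measurable φ := measurable_pi_lambda _ fun i => measurable_pi_apply _
  -- Inputs may repeat, so one index is chosen for each point of the range; on matrices of the form
  -- `h(Ω)` the choice is immaterial.
  let χ : Mat n d → (X → Pt d) := fun M x => M x.2.choose
  have hχ : Measurable χ := measurable_pi_lambda _ fun x => measurable_pi_apply _
  have hφX : φ ∘ X.domRestrict = evalAt Ω := rfl
  have hχΩ : χ ∘ evalAt Ω = X.domRestrict := by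
    ext1 h
    ext1 x
    exact congrArg h x.2.choose_spec
  have h1 : ∀ μ : Measure (Fun d), marginal Ω μ = (μ.map X.domRestrict).map φ := fun μ => by
    rw [marginal, Measure.map_map hφ hX, hφX]
  have h2 : ∀ μ : Measure (Fun d), μ.map X.domRestrict = (marginal Ω μ).map χ := fun μ => by
    rw [marginal, Measure.map_map hχ (measurable_evalAt Ω), hχΩ]
  refine le_antisymm ?_ ?_
  · rw [klDivOn, h2, h2]
    exact klDiv_map_le _ _ hχ
  · rw [klDivOn, h1, h1]
    exact klDiv_map_le _ _ hφ

theorem integral_empiricalMeasure {α G : Type*} [MeasurableSpace α] [MeasurableSingletonClass α]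
    [NormedAddCommGroup G] [NormedSpace ℝ G] [CompleteSpace G] {N : ℕ} (x : Fin N → α)
    (φ : α → G) : ∫ y, φ y ∂(empiricalMeasure x) = (N : ℝ)⁻¹ • ∑ j, φ (x j) := by
  rw [empiricalMeasure, integral_smul_measure,
    integral_finsetSum_measure fun i _ => integrable_dirac (by simp)]
  simp only [integral_dirac, ENNReal.toReal_inv, ENNReal.toReal_natCast]

end Transport

/-! ### The gradient formula for the transported process -/

section SteinGradient

variable {d : ℕ} {H : Type*} [NormedAddCommGroup H] [InnerProductSpace ℝ H] [CompleteSpace H]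
  [RKHS ℝ H (Pt d) (Pt d)] {κ : Pt d → Pt d → ℝ}

/-- A functional of the transported process that agrees along small multiples of each direction
with the divergence of the marginals at a regular `Ω` has the Stein gradient. -/
theorem hasFunctionalGradient_of_eventually_eq (hκ : RegularKernel κ)
    (hH : ∀ x y, RKHS.kernel H x y = κ x y • ContinuousLinearMap.id ℝ (Pt d)) {n : ℕ}
    (Ω : Mat n d) (Q P : Measure (Fun d)) [IsProbabilityMeasure Q] [IsProbabilityMeasure P]
    {p : Mat n d → ℝ} (hp : RegularDensity (marginal Ω Q) (marginal Ω P) p)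
    (hfin : klDiv (marginal Ω Q) (marginal Ω P) ≠ ∞) {F : H → ℝ≥0∞}
    (hF : ∀ f : H, ∀ᶠ ε : ℝ in 𝓝 0,
      F (ε • f) = klDiv (marginal Ω (Q.map (transport (ε • f : H)))) (marginal Ω P)) :
    HasFunctionalGradient F 0 (-∫ M, steinElement H n p M ∂(marginal Ω Q)) := by
  intro f
  have hfd := differentiable_coe hκ hH f
  obtain ⟨A, hA0, hA⟩ := exists_norm_coe_le hκ hH f
  obtain ⟨C, hC0, hC⟩ := exists_norm_fderiv_coe_le hκ hH f
  have hRd : Differentiable ℝ (rowwise f : Mat n d → Mat n d) := fun M =>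
    (hasFDerivAt_rowwise hfd M).differentiableAt
  obtain ⟨K, hK⟩ := klDiv_map_add_smul_expansion hp hfin hRd
    (fun M => (pi_norm_le_iff_of_nonneg hA0).2 fun i => hA (M i))
    (norm_fderiv_rowwise_le hfd hC0 hC)
  have hmap : ∀ ε : ℝ, marginal Ω (Q.map (transport (ε • f : H)))
      = (marginal Ω Q).map fun M => M + ε • rowwise f M := fun ε => by
    rw [marginal_map_transport (differentiable_coe hκ hH (ε • f)).continuous.measurable,
      RKHS.coe_smul]
    rfl
  have hF0 : F 0 = klDiv (marginal Ω Q) (marginal Ω P) := by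
    -- The eventual equality holds in a full neighbourhood of `0`, hence at `ε = 0`.
    have := (hF f).self_of_nhds
    rw [hmap, zero_smul] at this
    simpa using this
  have hinner : inner ℝ (-∫ M, steinElement H n p M ∂(marginal Ω Q)) f
      = -∫ M, firstVariation p (rowwise f) M ∂(marginal Ω Q) := by
    rw [inner_neg_left, real_inner_comm, ← integral_inner (integrable_steinElement hκ hH hp)]
    congr 1
    refine integral_congr_ae (ae_of_all _ fun M => ?_)
    dsimp only
    rw [real_inner_comm, inner_steinElement hκ hH hp.differentiable_log]
  simp only [zero_add]
  constructor
  · filter_upwards [hF f, hK] with ε h1 h2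
    rw [h1, hmap]
    exact h2.1
  · refine IsBigO.of_bound K ?_
    filter_upwards [hF f, hK] with ε h1 h2
    rw [h1, hmap, hF0, hinner, mul_neg, sub_neg_eq_add, Real.norm_eq_abs, Real.norm_eq_abs,
      abs_of_nonneg (sq_nonneg ε)]
    exact h2.2

end SteinGradient

end SteinProcess

end

/-! ### The theorem -/

open SteinProcess in
theorem theorem2 {d : ℕ} {H : Type*} [NormedAddCommGroup H] [InnerProductSpace ℝ H]
    [CompleteSpace H] [RKHS ℝ H (Pt d) (Pt d)]
    (κ : Pt d → Pt d → ℝ) (hκ : RegularKernel κ)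
    (hH : ∀ x y, RKHS.kernel H x y = κ x y • ContinuousLinearMap.id ℝ (Pt d))
    (Q P : Measure (Fun d)) [IsProbabilityMeasure Q] [IsProbabilityMeasure P] :
    ∃ Φ : (n : ℕ) → (Mat n d → ℝ) → Mat n d → H,
      (∀ n p M ω, Φ n p M ω = steinField κ p M ω) ∧
      (∀ (n : ℕ) (Ω : Mat n d) (p : Mat n d → ℝ),
        RegularDensity (marginal Ω Q) (marginal Ω P) p →
        klDiv Q P ≠ ∞ →
        (∀ f : H, ∀ᶠ ε : ℝ in 𝓝 0, KLSupReachedAt (Q.map (transport (ε • f))) P Ω) →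
        Integrable (fun h => Φ n p (evalAt Ω h)) Q ∧
        HasFunctionalGradient (fun g : H => klDiv (Q.map (transport g)) P) 0
          (-∫ h, Φ n p (evalAt Ω h) ∂Q) ∧
        (∫ h, Φ n p (evalAt Ω h) ∂Q ≠ 0 → ∀ u : H,
          IsSteepestDescentDirection (fun g : H => klDiv (Q.map (transport g)) P) 0 u ↔
            u = ‖∫ h, Φ n p (evalAt Ω h) ∂Q‖⁻¹ • ∫ h, Φ n p (evalAt Ω h) ∂Q)) ∧
      (∀ (R : ℕ) (Ω : Mat R d) (p : Mat R d → ℝ),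
        RegularDensity (marginal Ω Q) (marginal Ω P) p →
        klDivOn (empiricalMeasure Ω).support Q P ≠ ∞ →
        Integrable (Φ R p) (marginal Ω Q) ∧
        HasFunctionalGradient
          (fun g : H => klDivOn (empiricalMeasure Ω).support (Q.map (transport g)) P) 0
          (-∫ M, Φ R p M ∂(marginal Ω Q)) ∧
        (∫ M, Φ R p M ∂(marginal Ω Q) ≠ 0 → ∀ u : H,
          IsSteepestDescentDirection
            (fun g : H => klDivOn (empiricalMeasure Ω).support (Q.map (transport g)) P) 0 u ↔
            u = ‖∫ M, Φ R p M ∂(marginal Ω Q)‖⁻¹ • ∫ M, Φ R p M ∂(marginal Ω Q))) ∧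
      (∀ (R N : ℕ) (p : Mat R d → ℝ) (ε : ℝ) (Ω : Fin N → Mat R d) (m : Fin N) (i : Fin R),
        Ω m i + ε • (∫ M, Φ R p M ∂(empiricalMeasure Ω)) (Ω m i) = svgdUpdate κ p ε Ω m i) := by
  have hmarg : ∀ {n : ℕ} (Ω : Mat n d) (p : Mat n d → ℝ),
      RegularDensity (marginal Ω Q) (marginal Ω P) p →
      ∫ h, steinElement H n p (evalAt Ω h) ∂Q = ∫ M, steinElement H n p M ∂(marginal Ω Q) :=
    fun Ω p hp => (integral_map (measurable_evalAt Ω).aemeasurable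
      (integrable_steinElement hκ hH hp).aestronglyMeasurable).symm
  have hprob : ∀ g : H, IsProbabilityMeasure (Q.map (transport g)) := fun g =>
    Measure.isProbabilityMeasure_map
      (measurable_transport (differentiable_coe hκ hH g).continuous.measurable).aemeasurable
  refine ⟨steinElement H, steinElement_apply hκ hH, ?_, ?_, ?_⟩
  · intro n Ω p hp hfin hsup
    have hgrad : HasFunctionalGradient (fun g : H => klDiv (Q.map (transport g)) P) 0
        (-∫ h, steinElement H n p (evalAt Ω h) ∂Q) := by
      rw [hmarg Ω p hp]
      refine hasFunctionalGradient_of_eventually_eq hκ hH Ω Q P hp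
        (ne_top_of_le_ne_top hfin (klDiv_map_le _ _ (measurable_evalAt Ω))) fun f => ?_
      filter_upwards [hsup f] with ε hε
      have := hprob (ε • f)
      -- The divergence between processes is the supremum, which the hypothesis places at `Ω` for
      -- this `ε`.
      rw [klDiv_eq_marginalKLSup]
      exact hε.symm
    exact ⟨(integrable_steinElement hκ hH hp).comp_measurable (measurable_evalAt Ω), hgrad,
      fun hne u => hgrad.isSteepestDescentDirection_iff hne u⟩
  · intro R Ω p hp hfin
    rw [klDivOn_support_empiricalMeasure] at hfin
    have hgrad : HasFunctionalGradient
        (fun g : H => klDivOn (empiricalMeasure Ω).support (Q.map (transport g)) P) 0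
        (-∫ M, steinElement H R p M ∂(marginal Ω Q)) := by
      refine hasFunctionalGradient_of_eventually_eq hκ hH Ω Q P hp hfin fun f =>
        Eventually.of_forall fun ε => ?_
      have := hprob (ε • f)
      exact klDivOn_support_empiricalMeasure Ω _ P
    exact ⟨integrable_steinElement hκ hH hp, hgrad,
      fun hne u => hgrad.isSteepestDescentDirection_iff hne u⟩
  · intro R N p ε Ω m i
    rw [integral_empiricalMeasure, svgdUpdate, RKHS.coe_smul, Pi.smul_apply, smul_smul,
      div_eq_mul_inv]
    congr 2
    -- Linearity of the embedding into functions lets point evaluation pass through the finite sum.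
    rw [← RKHS.coeCLM_apply (𝕜 := ℝ), map_sum, Finset.sum_apply]
    refine Finset.sum_congr rfl fun j _ => ?_
    rw [RKHS.coeCLM_apply, steinElement_apply hκ hH]
    rfl
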